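/- Setting. Let $X$ be a Polish space with its Borel $\sigma$-field, $\mu$ a measure on $X$, and $\pi$ a continuous, everywhere positive, bounded probability density with respect to $\mu$; write $\pi$ also for the measure $\pi\,d\mu$. Let $T>1$, $\beta=1-1/T$, $\upsilon\in(0,1)$, $\tau\in(0,1/T)$ and $W=(\pi/\|\pi\|_\infty)^{-\tau}$. Let $\theta_\star$ be the probability measure with $\mu$-density proportional to $\pi^{1/T}$ (assumed to be normalisable), and let $\Theta$ be the set of all probability measures on $X$. Let $P$ be a Markov kernel on $X$ and, for $\theta\in\Theta$, let $$P_\theta=(1-\upsilon)P+\upsilon K_\theta,\qquad K_\theta(x,A)=\int_A\alpha(x,y)\,\theta(dy)+\mathbf 1_A(x)\int\{1-\alpha(x,y)\}\,\theta(dy),\qquad \alpha(x,y)=1\wedge\frac{\pi(y)^\beta}{\pi(x)^\beta}.$$ On a filtered probability space $(\Omega,\mathcal A,(\mathcal F_n)_{n\ge0},\mathbb P)$ let $(X_n)_{n\ge0}$, $(Y_n)_{n\ge0}$ be adapted $X$-valued processes, put $\theta_n=(n+1)^{-1}\sum_{k=0}^n\delta_{Y_k}$, and suppose that $\mathbb E[f(X_{n+1})\mid\mathcal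 F_n]=P_{\theta_n}f(X_n)$ a.s. for every $n$ and every bounded measurable $f$. For a function $V\ge1$ and probability measures $\mu_1,\mu_2$, put $\|\mu_1-\mu_2\|_V=\sup_{|f|\le V}|\mu_1(f)-\mu_2(f)|$. A set $S$ is $1$-small for $P$ if there are $\varepsilon>0$ and a probability measure $\nu$ with $P(x,\cdot)\ge\varepsilon\,\nu$ for all $x\in S$. Proposition 3.3. Assume: * (I2) $P$ is $\pi$-irreducible, aperiodic, Feller and satisfies $\pi P=\pi$; there are $\lambda\in(0,1)$ and $b<\infty$ with $PW\le\lambda W+b$; and for every $p\in(0,\|\pi\|_\infty)$ the set $\{\pi\ge p\}$ is $1$-small for $P$. * (I3) $\theta_\star(W)<\infty$; for every continuous $f$ with $\sup|f|/W<\infty$, $\theta_n(f)\to\theta_\star(f)$ a.s.; and $\sup_n\mathbb E[W(Y_n)]<\infty$. * $\mathbb E[W(X_0)]<\infty$. (Condition I1 is the continuity, positivity and boundedness of $\pi$ assumed above.) Then every $P_\theta$, $\theta\in\Theta$, has a unique invariant probability measure $\pi_\theta$, and the conditions of Theorem 2.11 hold: 1. There are a measurable function $V:X\to[1,\infty)$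 and, for every $\theta\in\Theta$, constants $b_\theta<\infty$, $\delta_\theta,\lambda_\theta\in(0,1)$ and a probability measure $\nu_\theta$ such that $P_\theta$ is $\pi$-irreducible and aperiodic, $P_\theta V\le\lambda_\theta V+b_\theta$, and $P_\theta(x,\cdot)\ge\delta_\theta\,\nu_\theta$ whenever $V(x)\le 2b_\theta(1-\lambda_\theta)^{-1}-1$. For these data there are constants $C_\theta<\infty$ and $\rho_\theta\in(0,1)$ such that $$\pi_\theta(V)\le \frac{b_\theta}{1-\lambda_\theta},\qquad \|P_\theta^n(x,\cdot)-\pi_\theta\|_V\le C_\theta\rho_\theta^nV(x)\quad(n\ge0,\ x\in X),$$ $$L_\theta:=C_\theta\vee(1-\rho_\theta)^{-1}\le C\{b_\theta\vee\delta_\theta^{-1}\vee(1-\lambda_\theta)^{-1}\}^\gamma\quad\text{for some } C,\gamma>0\text{ independent of }\theta,$$ and for every such choice of $(C_\theta,\rho_\theta)_{\theta\in\Theta}$ one has $\limsup_n L_{\theta_n}<\infty$ a.s. 2. For every bounded continuous $f$, the family of functions $\{P_\theta f:\theta\in\Theta\}$ is equicontinuous. 3. For every $x\in X$, almost surely $P_{\theta_n}(x,\cdot)$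 converges weakly to $P_{\theta_\star}(x,\cdot)$. Moreover, for every bounded continuous $f$, $\pi_{\theta_n}(f)\to\pi(f)$ a.s. -/

import Mathlib

open MeasureTheory ProbabilityTheory Filter Topology
open scoped ENNReal BoundedContinuousFunction

namespace InteractingTempering

noncomputable section

section Kernels

variable {X : Type*} [MeasurableSpace X]

/-- `P` is (weak) Feller: it maps bounded continuous functions to bounded continuous functions
(boundedness of the image is automatic for a Markov kernel). -/
def IsFeller [TopologicalSpace X] (P : Kernel X X) : Prop :=
  ∀ f : X →ᵇ ℝ, Continuous fun x => ∫ y, f y ∂(P x)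

/-- Aperiodicity of a kernel that is irreducible with respect to some non-zero measure: there is
no cycle of length `d ≥ 2` of nonempty pairwise disjoint sets. (The union of such a cycle is
absorbing, so by irreducibility its complement is null for every irreducibility measure.) -/
def IsAperiodic (P : Kernel X X) : Prop :=
  ∀ d : ℕ, 2 ≤ d → ¬ ∃ D : ZMod d → Set X,
    (∀ i, MeasurableSet (D i)) ∧ (∀ i, (D i).Nonempty) ∧
    (∀ i j, i ≠ j → Disjoint (D i) (D j)) ∧
    ∀ i, ∀ x ∈ D i, P x (D (i + 1)) = 1

/-- `S` is `1`-small for `P`: `P(x, ·) ≥ ε ν` for all `x ∈ S`, for some `ε > 0` and some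
probability measure `ν`. -/
def IsOneSmall (P : Kernel X X) (S : Set X) : Prop :=
  ∃ ε : ℝ≥0∞, 0 < ε ∧ ∃ ν : Measure X, IsProbabilityMeasure ν ∧
    ∀ x ∈ S, ∀ A, MeasurableSet A → ε * ν A ≤ P x A

/-- The `V`-distance `sup_{|f| ≤ V} |μ₁(f) - μ₂(f)|`. It is used only for measures that
integrate `V`. -/
def vDist (V : X → ℝ) (μ₁ μ₂ : Measure X) : ℝ≥0∞ :=
  ⨆ (f : X → ℝ) (_ : Measurable f) (_ : ∀ x, |f x| ≤ V x),
    ENNReal.ofReal |∫ x, f x ∂μ₁ - ∫ x, f x ∂μ₂|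

variable {Θ : Type*}

/-- Simultaneous geometric drift and minorization conditions for a family `P` of Markov kernels,
with drift function `V ≥ 1` (the same for all `θ`), constants `b θ`, `δ θ`, `lam θ` and
minorizing probability measures `ν θ`. The measure `φ` is the reference measure for
irreducibility. -/
structure DriftMinorization (φ : Measure X) (P : Θ → Kernel X X) (V : X → ℝ)
    (b δ lam : Θ → ℝ) (ν : Θ → Measure X) : Prop where
  markov : ∀ θ, IsMarkovKernel (P θ)
  irreducible : ∀ θ, Kernel.IsIrreducible φ (P θ)
  aperiodic : ∀ θ, IsAperiodic (P θ)
  measurable_V : Measurable V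
  one_le_V : ∀ x, 1 ≤ V x
  delta_mem : ∀ θ, δ θ ∈ Set.Ioo (0 : ℝ) 1
  lam_mem : ∀ θ, lam θ ∈ Set.Ioo (0 : ℝ) 1
  prob_nu : ∀ θ, IsProbabilityMeasure (ν θ)
  drift : ∀ θ x, ∫⁻ y, ENNReal.ofReal (V y) ∂(P θ x) ≤ ENNReal.ofReal (lam θ * V x + b θ)
  minorization : ∀ θ x, V x ≤ 2 * b θ * (1 - lam θ)⁻¹ - 1 →
    ∀ A, MeasurableSet A → ENNReal.ofReal (δ θ) * ν θ A ≤ P θ x A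

/-- `L_θ = C_θ ∨ (1 - ρ_θ)⁻¹`. -/
def rateConst (C ρ : Θ → ℝ) (θ : Θ) : ℝ := max (C θ) (1 - ρ θ)⁻¹

/-- `C θ`, `ρ θ` are admissible constants of `V`-geometric ergodicity for `P θ`, with invariant
distribution `πinv θ`: the `V`-distance between `P_θ^n(x, ·)` and `π_θ` is at most
`C_θ ρ_θ^n V(x)`, and `L_θ` is at most a power of the drift and minorization constants, up to a
factor, both uniform in `θ`. -/
structure IsErgodicRate (P : Θ → Kernel X X) (πinv : Θ → ProbabilityMeasure X) (V : X → ℝ)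
    (b δ lam : Θ → ℝ) (C ρ : Θ → ℝ) : Prop where
  invariant : ∀ θ, Kernel.Invariant (P θ) (πinv θ : Measure X)
  moment : ∀ θ, ∫⁻ x, ENNReal.ofReal (V x) ∂(πinv θ : Measure X)
    ≤ ENNReal.ofReal (b θ * (1 - lam θ)⁻¹)
  rho_mem : ∀ θ, ρ θ ∈ Set.Ioo (0 : ℝ) 1
  ergodic : ∀ θ (n : ℕ) x, vDist V ((P θ ^ n) x) (πinv θ : Measure X)
    ≤ ENNReal.ofReal (C θ * ρ θ ^ n * V x)
  bound : ∃ C₀ γ : ℝ, 0 < C₀ ∧ 0 < γ ∧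
    ∀ θ, rateConst C ρ θ ≤ C₀ * (max (b θ) (max (δ θ)⁻¹ (1 - lam θ)⁻¹)) ^ γ

/-- The conditions of the criterion for almost sure weak convergence of the invariant
distributions `π_{θ_n}` to `π_{θ⋆}`:
* the drift and minorization conditions hold (with constants for which admissible ergodicity
  constants exist), and `limsup_n L_{θ_n} < ∞` almost surely, for all admissible constants `L`;
* for every bounded continuous `f`, the family `{P_θ f : θ ∈ Θ}` is equicontinuous;
* for every `x`, almost surely `P_{θ_n}(x, ·)` converges weakly to `P_{θ⋆}(x, ·)`. -/
structure InvariantConvergenceConditions [TopologicalSpace X] {Ω : Type*} [MeasurableSpace Ω]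
    (Pr : Measure Ω) (φ : Measure X) (P : Θ → Kernel X X) (πinv : Θ → ProbabilityMeasure X)
    (θ : ℕ → Ω → Θ) (θstar : Θ) : Prop where
  ergodicity : ∃ (V : X → ℝ) (b δ lam : Θ → ℝ) (ν : Θ → Measure X),
    DriftMinorization φ P V b δ lam ν ∧
    (∃ C ρ : Θ → ℝ, IsErgodicRate P πinv V b δ lam C ρ) ∧
    ∀ C ρ : Θ → ℝ, IsErgodicRate P πinv V b δ lam C ρ →
      ∀ᵐ ω ∂Pr, limsup (fun n => ENNReal.ofReal (rateConst C ρ (θ n ω))) atTop < ⊤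
  equicontinuous : ∀ f : X →ᵇ ℝ, Equicontinuous fun (t : Θ) (x : X) => ∫ y, f y ∂(P t x)
  weak_convergence : ∀ x, ∀ᵐ ω ∂Pr, ∀ f : X →ᵇ ℝ,
    Tendsto (fun n => ∫ y, f y ∂(P (θ n ω) x)) atTop (𝓝 (∫ y, f y ∂(P θstar x)))

end Kernels

section Algorithm

variable {X : Type*} [MeasurableSpace X]

/-- The acceptance probability `α(x, y) = 1 ∧ π(y)^β / π(x)^β`. -/
def accept (p : X → ℝ) (β : ℝ) (x y : X) : ℝ := min 1 (p y ^ β / p x ^ β)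

theorem measurable_accept {p : X → ℝ} (hp : Measurable p) (β : ℝ) :
    Measurable fun z : X × X => accept p β z.1 z.2 :=
  measurable_const.min
    (((hp.comp measurable_snd).pow_const β).div ((hp.comp measurable_fst).pow_const β))

/-- The kernel `K_θ(x, A) = ∫_A α(x, y) θ(dy) + 1_A(x) ∫ (1 - α(x, y)) θ(dy)`. -/
def interactionKernel (p : X → ℝ) (hp : Measurable p) (β : ℝ) (θ : ProbabilityMeasure X) :
    Kernel X X where
  toFun x := (θ : Measure X).withDensity (fun y => ENNReal.ofReal (accept p β x y)) +
    (∫⁻ y, ENNReal.ofReal (1 - accept p β x y) ∂(θ : Measure X)) • Measure.dirac x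
  measurable' := by
    refine Measure.measurable_of_measurable_coe _ fun A hA => ?_
    simp only [Measure.add_apply, Measure.smul_apply, smul_eq_mul, withDensity_apply _ hA]
    refine Measurable.add ?_ (Measurable.mul ?_ ?_)
    · exact (measurable_accept hp β).ennreal_ofReal.lintegral_prod_right'
    · exact (measurable_const.sub (measurable_accept hp β)).ennreal_ofReal.lintegral_prod_right'
    · exact (Measure.measurable_coe hA).comp Measure.measurable_dirac

/-- The transition kernel `P_θ = (1 - υ) P + υ K_θ`. -/
def itKernel (υ : ℝ) (P : Kernel X X) (p : X → ℝ) (hp : Measurable p) (β : ℝ)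
    (θ : ProbabilityMeasure X) : Kernel X X where
  toFun x := ENNReal.ofReal (1 - υ) • P x +
    ENNReal.ofReal υ • interactionKernel p hp β θ x
  measurable' := by
    refine Measure.measurable_of_measurable_coe _ fun A hA => ?_
    simp only [Measure.add_apply, Measure.smul_apply, smul_eq_mul]
    exact ((Kernel.measurable_coe _ hA).const_mul _).add
      ((Kernel.measurable_coe _ hA).const_mul _)

/-- The probability measure with density `p` with respect to `μ`. -/
def targetMeasure (μ : Measure X) (p : X → ℝ) : Measure X :=
  μ.withDensity fun x => ENNReal.ofReal (p x)

/-- The normalised measure with density proportional to `p ^ s` with respect to `μ`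
(a probability measure when the integral of `p ^ s` is positive and finite). -/
def temperedMeasure (μ : Measure X) (p : X → ℝ) (s : ℝ) : Measure X :=
  (∫⁻ x, ENNReal.ofReal (p x ^ s) ∂μ)⁻¹ • μ.withDensity fun x => ENNReal.ofReal (p x ^ s)

/-- The supremum norm of `p`; it is used only for bounded `p`. -/
def supNorm (p : X → ℝ) : ℝ := ⨆ x, |p x|

/-- `W(x) = (π(x) / ‖π‖_∞) ^ (-τ)`. -/
def lyapunov (p : X → ℝ) (τ : ℝ) (x : X) : ℝ := (p x / supNorm p) ^ (-τ)

/-- The empirical distribution `θ_n = (n + 1)⁻¹ ∑_{k = 0}^n δ_{Y_k}`. -/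
def empirical {Ω : Type*} (Y : ℕ → Ω → X) (n : ℕ) (ω : Ω) : ProbabilityMeasure X :=
  ⟨((n : ℝ≥0∞) + 1)⁻¹ • ∑ k ∈ Finset.range (n + 1), Measure.dirac (Y k ω), ⟨by
    simp only [Measure.smul_apply, Measure.coe_finsetSum, Finset.sum_apply, measure_univ,
      Finset.sum_const, Finset.card_range, smul_eq_mul, nsmul_eq_mul, mul_one]
    push_cast
    exact ENNReal.inv_mul_cancel (by simp) (by finiteness)⟩⟩

end Algorithm

end

end InteractingTempering

/-! Everything rests on Harris' theorem with explicit constants. If a kernel satisfies `Q V ≤ lam V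
+ b` and a minorization of mass `δ` on a sublevel set of `V`, it contracts oscillations weighted by
`1 + δ/(2b) V` at rate `1 - (1 - lam) δ / 4` (`HasDrift.contraction`). Existence and uniqueness of
the invariant law and the geometric rate follow without compactness, with constants polynomial in
`b`, `δ⁻¹` and `(1 - lam)⁻¹`.

For the tempering kernels the drift function is a power `V = (p / ‖p‖)^(-σ)` with `σ = min τ β`.
Since `σ ≤ τ`, the drift of `P` passes to `V` by concavity; since `σ ≤ β`, the acceptance
probability absorbs the growth of `V` (`accept_mul_lyapunov_le`). Hence `K_θ V ≤ V + c_θ` for every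
`θ`, even when `θ(V) = ∞`, and `c_θ = θ(V)` when that is finite. So `P_θ` has the common drift rate
`(1 - υ) lam_P + υ < 1`, and only the additive constant depends on `θ`. Sublevel sets of `V` are
superlevel sets of `p`, small for `P` and thus for `P_θ ≥ (1 - υ) P`. All constants stay bounded
when `θ(V)` does (`exists_harrisCondition`); along `θ_n` this holds almost surely because `θ_n(V) →
θ⋆(V)`.

For the convergence of `π_{θ_n}`, countably many test sets yield one null event outside which `θ_n →
θ⋆` weakly. One-step transitions then converge, and equicontinuity of `P_θ f` in `θ` carries this to
every iterate `P_{θ_n}^k` (`tendsto_integral_pow`). The uniform geometric rate lets `k → ∞` be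
exchanged with `n → ∞` (`tendsto_integral_invariant`). The limit is `π`, since at the tempered law
`θ⋆` the interaction kernel is a Metropolis–Hastings kernel reversible for `π`. -/

namespace InteractingTempering

/-! ### Drift conditions and the one-step contraction -/

section Harris

variable {X : Type*} [MeasurableSpace X]

/-- Geometric drift condition `Q V ≤ lam V + b` with a drift function `V ≥ 1`. -/
structure HasDrift (Q : Kernel X X) (V : X → ℝ) (lam b : ℝ) : Prop where
  measurable : Measurable V
  one_le : ∀ x, 1 ≤ V x
  lam_pos : 0 < lam
  lam_lt : lam < 1
  b_pos : 0 < b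
  drift : ∀ x, ∫⁻ y, ENNReal.ofReal (V y) ∂(Q x) ≤ ENNReal.ofReal (lam * V x + b)

theorem integral_bind_kernel {κ : Kernel X X} {m : Measure X} {f : X → ℝ}
    (hf : Integrable f (m.bind κ)) :
    ∫ x, f x ∂(m.bind κ) = ∫ x, ∫ y, f y ∂(κ x) ∂m := by
  have h := Measure.comp_eq_comp_const_apply (μ := m) (κ := κ)
  rw [h] at hf ⊢
  rw [Kernel.integral_comp hf]
  simp

theorem integral_pow_succ {Q : Kernel X X} {n : ℕ} {x : X} {f : X → ℝ}
    (hf : Integrable f ((Q ^ (n + 1)) x)) :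
    ∫ z, f z ∂((Q ^ (n + 1)) x) = ∫ y, ∫ z, f z ∂((Q ^ n) y) ∂(Q x) := by
  rw [pow_succ] at hf ⊢
  exact Kernel.integral_comp hf

theorem lintegral_pow_succ {Q : Kernel X X} {n : ℕ} {x : X} {f : X → ℝ≥0∞} (hf : Measurable f) :
    ∫⁻ z, f z ∂((Q ^ (n + 1)) x) = ∫⁻ y, ∫⁻ z, f z ∂((Q ^ n) y) ∂(Q x) := by
  rw [pow_succ]
  exact Kernel.lintegral_comp _ _ _ hf

instance isMarkovKernel_pow (Q : Kernel X X) [IsMarkovKernel Q] (n : ℕ) :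
    IsMarkovKernel (Q ^ n) := by
  induction n with
  | zero => rw [pow_zero]; exact inferInstanceAs (IsMarkovKernel (Kernel.id : Kernel X X))
  | succ n ih => rw [pow_succ]; exact inferInstanceAs (IsMarkovKernel ((Q ^ n) ∘ₖ Q))

theorem pow_zero_apply (Q : Kernel X X) (x : X) : (Q ^ 0) x = Measure.dirac x := by
  rw [pow_zero]; exact Kernel.id_apply x

theorem invariant_pow {Q : Kernel X X} {η : Measure X} (h : Kernel.Invariant Q η) (n : ℕ) :
    Kernel.Invariant (Q ^ n) η := by
  induction n with
  | zero => rw [pow_zero]; exact Measure.id_comp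
  | succ n ih => rw [pow_succ]; exact ih.comp h

theorem integrable_of_abs_le {m : Measure X} {f V : X → ℝ} {c : ℝ} (hV : Integrable V m)
    (hf : Measurable f) (h : ∀ x, |f x| ≤ c * V x) : Integrable f m :=
  (hV.const_mul c).mono' hf.aestronglyMeasurable (ae_of_all _ h)

/-- Every `g x - K G x` lies below every `g y + K G y`, so the supremum of the former is a valid
centre. This trades a two-point oscillation bound for a weighted sup-norm bound, which can be
integrated against a single measure. -/
theorem exists_shift {X : Type*} [Nonempty X] {g G : X → ℝ} {K : ℝ}
    (h : ∀ x y, |g x - g y| ≤ K * (G x + G y)) : ∃ c, ∀ x, |g x - c| ≤ K * G x := by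
  have hb : ∀ y, ∀ x, g x - K * G x ≤ g y + K * G y := fun y x => by
    have := (abs_le.1 (h x y)).2
    linarith
  have hbdd : BddAbove (Set.range fun x => g x - K * G x) :=
    ⟨_, Set.forall_mem_range.2 (hb (Classical.arbitrary X))⟩
  refine ⟨⨆ x, (g x - K * G x), fun x => abs_le.2 ⟨?_, ?_⟩⟩
  · have := ciSup_le (hb x)
    linarith
  · have := le_ciSup hbdd x
    linarith

namespace HasDrift

variable {Q : Kernel X X} {V : X → ℝ} {lam b : ℝ}

theorem V_nonneg (h : HasDrift Q V lam b) (x : X) : 0 ≤ V x := zero_le_one.trans (h.one_le x)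

theorem integrable_V (h : HasDrift Q V lam b) (x : X) : Integrable V (Q x) := by
  refine ⟨h.measurable.aestronglyMeasurable, ?_⟩
  rw [hasFiniteIntegral_iff_ofReal (ae_of_all _ h.V_nonneg)]
  exact (h.drift x).trans_lt ENNReal.ofReal_lt_top

theorem integral_V_le (h : HasDrift Q V lam b) (x : X) : ∫ y, V y ∂(Q x) ≤ lam * V x + b := by
  rw [integral_eq_lintegral_of_nonneg_ae (ae_of_all _ h.V_nonneg)
    h.measurable.aestronglyMeasurable]
  refine ENNReal.toReal_le_of_le_ofReal ?_ (h.drift x)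
  have := h.V_nonneg x; have := h.b_pos; have := h.lam_pos; positivity

theorem lintegral_pow_le [IsMarkovKernel Q] (h : HasDrift Q V lam b) (n : ℕ) (x : X) :
    ∫⁻ y, ENNReal.ofReal (V y) ∂((Q ^ n) x)
      ≤ ENNReal.ofReal (lam ^ n * V x + b / (1 - lam)) := by
  have hl := h.lam_pos
  have hl1 : 0 < 1 - lam := sub_pos.2 h.lam_lt
  have hb := h.b_pos
  have hVm := h.measurable.ennreal_ofReal
  have hpow : ∀ n : ℕ, 0 ≤ 1 - lam ^ n := fun n => sub_nonneg.2 (pow_le_one₀ hl.le h.lam_lt.le)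
  -- The partial geometric sum is kept in the induction: with `b / (1 - lam)` itself in the
  -- hypothesis the step would not close.
  suffices H : ∫⁻ y, ENNReal.ofReal (V y) ∂((Q ^ n) x)
      ≤ ENNReal.ofReal (lam ^ n * V x + b * (1 - lam ^ n) / (1 - lam)) by
    refine H.trans (ENNReal.ofReal_le_ofReal ?_)
    have : 0 ≤ lam ^ n := by positivity
    gcongr
    nlinarith
  induction n generalizing x with
  | zero =>
    rw [pow_zero_apply, lintegral_dirac' _ hVm]
    simp
  | succ n ih =>
    rw [lintegral_pow_succ hVm]
    have hn := hpow n
    have h1 : ∀ y, ENNReal.ofReal (lam ^ n * V y + b * (1 - lam ^ n) / (1 - lam)) =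
        ENNReal.ofReal (lam ^ n) * ENNReal.ofReal (V y)
          + ENNReal.ofReal (b * (1 - lam ^ n) / (1 - lam)) := by
      intro y
      have := h.V_nonneg y
      rw [ENNReal.ofReal_add (by positivity) (by positivity), ENNReal.ofReal_mul (by positivity)]
    simp_rw [h1] at ih
    calc ∫⁻ y, ∫⁻ z, ENNReal.ofReal (V z) ∂((Q ^ n) y) ∂(Q x)
        ≤ ∫⁻ y, (ENNReal.ofReal (lam ^ n) * ENNReal.ofReal (V y)
            + ENNReal.ofReal (b * (1 - lam ^ n) / (1 - lam))) ∂(Q x) := lintegral_mono ih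
      _ = ENNReal.ofReal (lam ^ n) * ∫⁻ y, ENNReal.ofReal (V y) ∂(Q x)
            + ENNReal.ofReal (b * (1 - lam ^ n) / (1 - lam)) := by
          rw [lintegral_add_right _ measurable_const, lintegral_const_mul _ hVm, lintegral_const,
            measure_univ, mul_one]
      _ ≤ ENNReal.ofReal (lam ^ n) * ENNReal.ofReal (lam * V x + b)
            + ENNReal.ofReal (b * (1 - lam ^ n) / (1 - lam)) := by gcongr; exact h.drift x
      _ = _ := by
          have := h.V_nonneg x
          rw [← ENNReal.ofReal_mul (by positivity), ← ENNReal.ofReal_add (by positivity)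
            (by positivity)]
          congr 1
          field_simp
          ring

theorem integrable_V_pow [IsMarkovKernel Q] (h : HasDrift Q V lam b) (n : ℕ) (x : X) :
    Integrable V ((Q ^ n) x) := by
  refine ⟨h.measurable.aestronglyMeasurable, ?_⟩
  rw [hasFiniteIntegral_iff_ofReal (ae_of_all _ h.V_nonneg)]
  exact (h.lintegral_pow_le n x).trans_lt ENNReal.ofReal_lt_top

theorem integral_V_pow_le [IsMarkovKernel Q] (h : HasDrift Q V lam b) (n : ℕ) (x : X) :
    ∫ y, V y ∂((Q ^ n) x) ≤ lam ^ n * V x + b / (1 - lam) := by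
  rw [integral_eq_lintegral_of_nonneg_ae (ae_of_all _ h.V_nonneg)
    h.measurable.aestronglyMeasurable]
  refine ENNReal.toReal_le_of_le_ofReal ?_ (h.lintegral_pow_le n x)
  have := h.V_nonneg x; have := h.b_pos; have := h.lam_pos; have := sub_pos.2 h.lam_lt; positivity

theorem abs_integral_pow_le [IsMarkovKernel Q] (h : HasDrift Q V lam b) {f : X → ℝ} {c : ℝ}
    (hf : Measurable f) (hc : ∀ x, |f x| ≤ c * V x) (n : ℕ) (x : X) :
    |∫ y, f y ∂((Q ^ n) x)| ≤ c * (lam ^ n + b / (1 - lam)) * V x := by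
  have hV := h.one_le x
  have hc0 : 0 ≤ c := nonneg_of_mul_nonneg_left ((abs_nonneg _).trans (hc x)) (by linarith)
  have hl1 : 0 < 1 - lam := sub_pos.2 h.lam_lt
  have hb := h.b_pos
  have hq : 0 < b / (1 - lam) := by positivity
  calc |∫ y, f y ∂((Q ^ n) x)| ≤ ∫ y, c * V y ∂((Q ^ n) x) :=
        (abs_integral_le_integral_abs).trans <| integral_mono
          (integrable_of_abs_le (h.integrable_V_pow n x) hf hc).abs
          ((h.integrable_V_pow n x).const_mul c) hc
    _ = c * ∫ y, V y ∂((Q ^ n) x) := integral_const_mul _ _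
    _ ≤ c * (lam ^ n * V x + b / (1 - lam)) := by gcongr; exact h.integral_V_pow_le n x
    _ ≤ _ := by
      rw [mul_assoc]
      gcongr
      nlinarith

/-- One-step contraction of the weighted oscillation. -/
theorem contraction [IsMarkovKernel Q] (h : HasDrift Q V lam b) {δ : ℝ}
    (hδ : δ ∈ Set.Ioo (0 : ℝ) 1) {ν : Measure X} [IsProbabilityMeasure ν]
    (hmin : ∀ x, V x ≤ 4 * b / (1 - lam) - 1 → ∀ A, MeasurableSet A →
      ENNReal.ofReal δ * ν A ≤ Q x A)
    {g : X → ℝ} (hg : Measurable g) {c : ℝ} (hgc : ∀ x, |g x| ≤ c * V x) {K : ℝ} (hK : 0 ≤ K)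
    (hosc : ∀ x y, |g x - g y| ≤ K * ((1 + δ / (2 * b) * V x) + (1 + δ / (2 * b) * V y)))
    (x y : X) :
    |∫ z, g z ∂(Q x) - ∫ z, g z ∂(Q y)| ≤
      (1 - (1 - lam) * δ / 4) * K * ((1 + δ / (2 * b) * V x) + (1 + δ / (2 * b) * V y)) := by
  obtain ⟨hδ0, hδ1⟩ := hδ
  have hb := h.b_pos
  have hl := h.lam_pos
  have hl1 : 0 < 1 - lam := sub_pos.2 h.lam_lt
  have : Nonempty X := ⟨x⟩
  -- With this weight the additive drift terms at `x` and `y` total `2βb = δ`, half of the `2δ` that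
  -- the minorization saves.
  set β := δ / (2 * b) with hβ
  have hβ0 : 0 < β := by positivity
  have hβb : 2 * (β * b) = δ := by rw [hβ]; field_simp
  obtain ⟨a, ha⟩ := exists_shift hosc
  have hGm : Measurable fun x => 1 + β * V x := (h.measurable.const_mul β).const_add 1
  have hgi : ∀ x, Integrable g (Q x) := fun x => integrable_of_abs_le (h.integrable_V x) hg hgc
  have hGi : ∀ x, Integrable (fun x => 1 + β * V x) (Q x) := fun x =>
    (integrable_const 1).add ((h.integrable_V x).const_mul β)
  have hQG : ∀ x, ∫ z, (1 + β * V z) ∂(Q x) ≤ 1 + β * (lam * V x + b) := fun x => by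
    rw [integral_add (integrable_const 1) ((h.integrable_V x).const_mul β), integral_const_mul]
    simp only [integral_const, probReal_univ, smul_eq_mul, mul_one]
    have := h.integral_V_le x
    gcongr
  have hsub : ∀ x, ∫ z, g z ∂(Q x) = ∫ z, (g z - a) ∂(Q x) + a := fun x => by
    rw [integral_sub (hgi x) (integrable_const a)]; simp
  have hgai : ∀ x, Integrable (fun z => g z - a) (Q x) := fun x =>
    (hgi x).sub (integrable_const a)
  rw [hsub x, hsub y, add_sub_add_right_eq_sub]
  have hVx := h.one_le x
  have hVy := h.one_le y
  -- If `V x + V y` is large, drift alone contracts. Otherwise, as `V ≥ 1`, each value is at most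
  -- the threshold minus one, so both points lie in the small set.
  rcases le_or_gt (4 * b / (1 - lam)) (V x + V y) with hS | hS
  · have key : ∀ x, |∫ z, (g z - a) ∂(Q x)| ≤ K * (1 + β * (lam * V x + b)) := fun x =>
      calc |∫ z, (g z - a) ∂(Q x)| ≤ ∫ z, K * (1 + β * V z) ∂(Q x) :=
            abs_integral_le_integral_abs.trans <|
              integral_mono (hgai x).abs ((hGi x).const_mul K) ha
        _ ≤ _ := by rw [integral_const_mul]; gcongr; exact hQG x
    have hS' : 2 * δ ≤ (1 - lam) * (β * (V x + V y)) := by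
      rw [div_le_iff₀ hl1] at hS
      nlinarith
    calc _ ≤ K * (1 + β * (lam * V x + b)) + K * (1 + β * (lam * V y + b)) :=
          (abs_sub _ _).trans (add_le_add (key x) (key y))
      _ = K * (2 + lam * (β * (V x + V y)) + δ) := by rw [← hβb]; ring
      _ ≤ K * ((1 - (1 - lam) * δ / 4) * (2 + β * (V x + V y))) := by
          gcongr
          nlinarith
      _ = _ := by ring
  · have hle : ∀ x, V x ≤ 4 * b / (1 - lam) - 1 → ENNReal.ofReal δ • ν ≤ Q x := fun x hx =>
      Measure.le_iff.2 fun A hA => by simpa using hmin x hx A hA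
    have hx' : V x ≤ 4 * b / (1 - lam) - 1 := by linarith
    have hy' : V y ≤ 4 * b / (1 - lam) - 1 := by linarith
    -- The contribution of the common part `δ ν` cancels in the difference; each remainder `Q x - δ
    -- ν` has weighted mass reduced by at least `δ`.
    set J := ∫ z, (g z - a) ∂(ENNReal.ofReal δ • ν) with hJ
    have hGδ : δ ≤ ∫ z, (1 + β * V z) ∂(ENNReal.ofReal δ • ν) := by
      have h1 : ∫ z, (1 : ℝ) ∂(ENNReal.ofReal δ • ν) = δ := by
        simp [hδ0.le]
      refine h1.symm.le.trans <| integral_mono ((integrable_const 1).mono_measure (hle x hx'))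
        ((hGi x).mono_measure (hle x hx')) fun z => ?_
      have := h.V_nonneg z
      simp only
      nlinarith
    have key : ∀ x, V x ≤ 4 * b / (1 - lam) - 1 →
        |∫ z, (g z - a) ∂(Q x) - J| ≤ K * (1 + β * (lam * V x + b) - δ) := fun x hx => by
      have hGx := hQG x
      have hmono : ∀ u : X → ℝ, Integrable u (Q x) → (∀ z, 0 ≤ u z) →
          ∫ z, u z ∂(ENNReal.ofReal δ • ν) ≤ ∫ z, u z ∂(Q x) := fun u hu hu0 =>
        integral_mono_measure (hle x hx) (ae_of_all _ hu0) hu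
      have hKG := (hGi x).const_mul K
      -- The functions `K (1 + βV) ∓ (g - a)` are nonnegative, so `δ ν ≤ Q x` compares their
      -- integrals without forming the difference measure.
      have e1 := hmono (fun z => K * (1 + β * V z) - (g z - a)) (hKG.sub (hgai x)) fun z => by
        have := (abs_le.1 (ha z)).2; linarith
      have e2 := hmono (fun z => K * (1 + β * V z) + (g z - a)) (hKG.add (hgai x)) fun z => by
        have := (abs_le.1 (ha z)).1; linarith
      rw [integral_sub hKG (hgai x), integral_sub (hKG.mono_measure (hle x hx))
        ((hgai x).mono_measure (hle x hx)), integral_const_mul, integral_const_mul] at e1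
      rw [integral_add hKG (hgai x), integral_add (hKG.mono_measure (hle x hx))
        ((hgai x).mono_measure (hle x hx)), integral_const_mul, integral_const_mul] at e2
      have e3 := mul_le_mul_of_nonneg_left hGx hK
      have e4 := mul_le_mul_of_nonneg_left hGδ hK
      rw [abs_le]
      constructor <;> linarith
    calc _ = |(∫ z, (g z - a) ∂(Q x) - J) - (∫ z, (g z - a) ∂(Q y) - J)| := by
            rw [sub_sub_sub_cancel_right]
      _ ≤ K * (1 + β * (lam * V x + b) - δ) + K * (1 + β * (lam * V y + b) - δ) :=
          (abs_sub _ _).trans (add_le_add (key x hx') (key y hy'))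
      _ = K * (2 + lam * (β * (V x + V y)) - δ) := by rw [← hβb]; ring
      _ ≤ K * ((1 - (1 - lam) * δ / 4) * (2 + β * (V x + V y))) := by
          have ht : 0 ≤ β * (V x + V y) := by nlinarith
          have ht' : 0 ≤ (1 - lam) * (β * (V x + V y)) := by positivity
          gcongr
          nlinarith
      _ = _ := by ring

end HasDrift
end Harris
-- Invariant law and geometric ergodicity
section Harris

variable {X : Type*} [MeasurableSpace X]

/-- A set function which is a uniform limit of probability measures is a probability measure. -/
theorem exists_probabilityMeasure_of_uniform_limit {m : ℕ → Measure X}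
    [∀ n, IsProbabilityMeasure (m n)] {L : Set X → ℝ} {ε : ℕ → ℝ} (hε : Tendsto ε atTop (𝓝 0))
    (hL : ∀ n A, MeasurableSet A → |(m n).real A - L A| ≤ ε n) :
    ∃ η : Measure X, IsProbabilityMeasure η ∧ ∀ A, MeasurableSet A → η.real A = L A := by
  have hlim : ∀ A, MeasurableSet A → Tendsto (fun n => (m n).real A) atTop (𝓝 (L A)) :=
    fun A hA => tendsto_iff_dist_tendsto_zero.2 <|
      squeeze_zero (fun _ => dist_nonneg) (fun n => hL n A hA) hε
  have hL0 : ∀ A, MeasurableSet A → 0 ≤ L A := fun A hA =>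
    ge_of_tendsto' (hlim A hA) fun n => measureReal_nonneg
  have hempty : L ∅ = 0 := tendsto_nhds_unique (hlim ∅ .empty) (by simp)
  have hsum : ∀ f : ℕ → Set X, (∀ i, MeasurableSet (f i)) → Pairwise (Function.onFun Disjoint f) →
      HasSum (fun i => L (f i)) (L (⋃ i, f i)) := by
    intro f hf hd
    rw [hasSum_iff_tendsto_nat_of_nonneg fun i => hL0 _ (hf i)]
    have hfin : ∀ n k, (m n).real (⋃ i ∈ Finset.range k, f i)
        = ∑ i ∈ Finset.range k, (m n).real (f i) := fun n k =>
      measureReal_biUnion_finset (fun i _ j _ hij => hd hij) fun i _ => hf i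
    have hmeas : ∀ k, MeasurableSet (⋃ i ∈ Finset.range k, f i) := fun k =>
      Finset.measurableSet_biUnion _ fun i _ => hf i
    have hLfin : ∀ k, L (⋃ i ∈ Finset.range k, f i) = ∑ i ∈ Finset.range k, L (f i) := fun k =>
      tendsto_nhds_unique (hlim _ (hmeas k)) <| by
        simp_rw [hfin]
        exact tendsto_finsetSum _ fun i _ => hlim _ (hf i)
    have hms : ∀ n, Tendsto (fun k => ∑ i ∈ Finset.range k, (m n).real (f i)) atTop
        (𝓝 ((m n).real (⋃ i, f i))) := fun n => by
      have h1 : ∑' i, (m n) (f i) ≠ ⊤ := by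
        rw [← measure_iUnion hd hf]; exact measure_ne_top _ _
      have h2 := (ENNReal.hasSum_toReal h1).tendsto_sum_nat
      rwa [← ENNReal.tsum_toReal_eq fun i => measure_ne_top _ _, ← measure_iUnion hd hf] at h2
    -- Countable additivity survives by a three-epsilon argument: the error between `m n` and `L` is
    -- uniform over sets, so a single `n` serves all partial unions and the full union.
    rw [Metric.tendsto_atTop]
    intro e he
    obtain ⟨n, hn⟩ := (hε.eventually (gt_mem_nhds (show (0 : ℝ) < e / 3 by positivity))).exists
    obtain ⟨N, hN⟩ := Metric.tendsto_atTop.1 (hms n) (e / 3) (by positivity)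
    refine ⟨N, fun k hk => ?_⟩
    have h1 := hL n _ (hmeas k)
    rw [hfin, hLfin] at h1
    have h2 := hL n _ (MeasurableSet.iUnion hf)
    have h3 := hN k hk
    rw [Real.dist_eq] at h3 ⊢
    rw [abs_le] at h1 h2
    rw [abs_lt] at h3 ⊢
    constructor <;> linarith
  let η : Measure X := Measure.ofMeasurable (fun A _ => ENNReal.ofReal (L A)) (by simp [hempty])
    fun f hf hd => by
      rw [← (hsum f hf hd).tsum_eq,
        ENNReal.ofReal_tsum_of_nonneg (fun i => hL0 _ (hf i)) (hsum f hf hd).summable]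
  have hη : ∀ A, MeasurableSet A → η A = ENNReal.ofReal (L A) := fun A hA =>
    Measure.ofMeasurable_apply A hA
  refine ⟨η, ⟨?_⟩, fun A hA => ?_⟩
  · rw [hη _ .univ, ← ENNReal.ofReal_one]
    congr 1
    exact tendsto_nhds_unique (hlim _ .univ) (by simp)
  · rw [measureReal_def, hη A hA, ENNReal.toReal_ofReal (hL0 A hA)]

/-- Setwise convergence implies convergence of integrals of `[0, 1]`-valued functions. -/
theorem tendsto_integral_of_setwise {m : ℕ → Measure X} [∀ n, IsProbabilityMeasure (m n)]
    {η : Measure X} [IsProbabilityMeasure η]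
    (h : ∀ A, MeasurableSet A → Tendsto (fun n => (m n).real A) atTop (𝓝 (η.real A)))
    {g : X → ℝ} (hg : Measurable g) (h0 : ∀ x, 0 ≤ g x) (h1 : ∀ x, g x ≤ 1) :
    Tendsto (fun n => ∫ x, g x ∂(m n)) atTop (𝓝 (∫ x, g x ∂η)) := by
  have hint : ∀ (m : Measure X) [IsProbabilityMeasure m], Integrable g m := fun m _ =>
    (integrable_const (1 : ℝ)).mono' hg.aestronglyMeasurable (ae_of_all _ fun x => by
      rw [Real.norm_eq_abs, abs_of_nonneg (h0 x)]; exact h1 x)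
  -- The layer-cake formula reduces the claim to setwise convergence of `{t < g}`, with dominated
  -- convergence in `t` over `(0, 1]`.
  have hcake : ∀ (m : Measure X) [IsProbabilityMeasure m],
      ∫ x, g x ∂m = ∫ t in Set.Ioi (0 : ℝ), m.real {x | t < g x} := fun m _ =>
    (hint m).integral_eq_integral_meas_lt (ae_of_all _ h0)
  simp_rw [hcake]
  refine tendsto_integral_of_dominated_convergence ((Set.Ioc (0 : ℝ) 1).indicator 1) ?_ ?_ ?_ ?_
  · intro n
    have : Antitone fun t : ℝ => (m n).real {x | t < g x} := fun s t hst =>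
      measureReal_mono fun x hx => lt_of_le_of_lt hst hx
    exact this.measurable.aestronglyMeasurable
  · refine (integrable_indicator_iff measurableSet_Ioc).2 (integrableOn_const (C := (1 : ℝ)) ?_)
    exact ((Measure.restrict_apply_le _ _).trans_lt measure_Ioc_lt_top).ne
  · intro n
    refine (ae_restrict_iff' measurableSet_Ioi).2 (ae_of_all _ fun t ht => ?_)
    rw [Real.norm_eq_abs, abs_of_nonneg measureReal_nonneg]
    by_cases ht1 : t ≤ 1
    · rw [Set.indicator_of_mem (show t ∈ Set.Ioc (0 : ℝ) 1 from ⟨ht, ht1⟩)]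
      exact measureReal_le_one
    · have : {x | t < g x} = ∅ := by
        ext x
        simpa using (h1 x).trans (not_le.1 ht1).le
      rw [this]
      simp only [measureReal_empty]
      exact Set.indicator_nonneg (fun _ _ => zero_le_one) t
  · exact ae_of_all _ fun t => h _ (measurableSet_lt measurable_const hg)

/-- Drift and minorization conditions for a kernel, with room for Harris' theorem: the level of the
small set is twice the critical one. -/
structure HarrisCondition (Q : Kernel X X) (V : X → ℝ) (lam b δ : ℝ) (ν : Measure X) : Prop
    extends HasDrift Q V lam b where
  delta_mem : δ ∈ Set.Ioo (0 : ℝ) 1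
  minor : ∀ x, V x ≤ 4 * b / (1 - lam) - 1 → ∀ A, MeasurableSet A →
      ENNReal.ofReal δ * ν A ≤ Q x A

namespace HarrisCondition

variable {Q : Kernel X X} [IsMarkovKernel Q] {V : X → ℝ} {lam b δ : ℝ} {ν : Measure X}

theorem rate_mem {lam δ : ℝ} (hl : lam ∈ Set.Ioo (0 : ℝ) 1) (hδ : δ ∈ Set.Ioo (0 : ℝ) 1) :
    1 - (1 - lam) * δ / 4 ∈ Set.Ioo (0 : ℝ) 1 := by
  obtain ⟨h1, h2⟩ := hl
  obtain ⟨h3, h4⟩ := hδ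
  constructor <;> nlinarith

theorem osc_pow [IsProbabilityMeasure ν] (h : HarrisCondition Q V lam b δ ν) {g : X → ℝ} (hg : Measurable g) {c : ℝ}
    (hgc : ∀ x, |g x| ≤ c * V x) {K : ℝ} (hK : 0 ≤ K)
    (hosc : ∀ x y, |g x - g y| ≤ K * ((1 + δ / (2 * b) * V x) + (1 + δ / (2 * b) * V y)))
    (n : ℕ) (x y : X) :
    |∫ z, g z ∂((Q ^ n) x) - ∫ z, g z ∂((Q ^ n) y)| ≤ (1 - (1 - lam) * δ / 4) ^ n * K *
        ((1 + δ / (2 * b) * V x) + (1 + δ / (2 * b) * V y)) := by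
  have hρ := (rate_mem ⟨h.lam_pos, h.lam_lt⟩ h.delta_mem).1.le
  induction n generalizing x y with
  | zero =>
    rw [pow_zero_apply, pow_zero_apply, integral_dirac' _ _ hg.stronglyMeasurable,
      integral_dirac' _ _ hg.stronglyMeasurable, pow_zero, one_mul]
    exact hosc x y
  | succ n ih =>
    have hi : ∀ n x, Integrable g ((Q ^ n) x) := fun n x =>
      integrable_of_abs_le (h.integrable_V_pow n x) hg hgc
    rw [integral_pow_succ (hi _ _), integral_pow_succ (hi _ _)]
    have := h.contraction h.delta_mem h.minor
      (g := fun y => ∫ z, g z ∂((Q ^ n) y)) hg.stronglyMeasurable.integral_kernel.measurable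
      (h.abs_integral_pow_le hg hgc n) (mul_nonneg (pow_nonneg hρ n) hK) ih x y
    rw [pow_succ' (1 - _)]
    simpa only [mul_assoc] using this

theorem integral_weight_le {m : Measure X} [IsProbabilityMeasure m] {v : ℝ} {β : ℝ} (hβ : 0 ≤ β)
    (hV : Integrable V m) (hv : ∫ x, V x ∂m ≤ v) (a : ℝ) :
    ∫ y, (a + (1 + β * V y)) ∂m ≤ a + (1 + β * v) := by
  simp_rw [← add_assoc]
  rw [integral_add (integrable_const _) (hV.const_mul β), integral_const_mul]
  simp only [integral_const, probReal_univ, smul_eq_mul, one_mul]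
  gcongr

/-- Averaging the oscillation bound over the second starting point. -/
theorem osc_pow_measure [IsProbabilityMeasure ν] (h : HarrisCondition Q V lam b δ ν) {g : X → ℝ} (hg : Measurable g) {c : ℝ}
    (hgc : ∀ x, |g x| ≤ c * V x) {K : ℝ} (hK : 0 ≤ K)
    (hosc : ∀ x y, |g x - g y| ≤ K * ((1 + δ / (2 * b) * V x) + (1 + δ / (2 * b) * V y)))
    {m : Measure X} [IsProbabilityMeasure m] (hV : Integrable V m) {v : ℝ}
    (hv : ∫ x, V x ∂m ≤ v) (n : ℕ) (x : X) :
    |∫ z, g z ∂((Q ^ n) x) - ∫ y, ∫ z, g z ∂((Q ^ n) y) ∂m| ≤ (1 - (1 - lam) * δ / 4) ^ n * K *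
        ((1 + δ / (2 * b) * V x) + (1 + δ / (2 * b) * v)) := by
  have hρ := (rate_mem ⟨h.lam_pos, h.lam_lt⟩ h.delta_mem).1.le
  have hβ : 0 ≤ δ / (2 * b) := by have := h.b_pos; have := h.delta_mem.1; positivity
  have hi : Integrable (fun y => ∫ z, g z ∂((Q ^ n) y)) m :=
    integrable_of_abs_le hV hg.stronglyMeasurable.integral_kernel.measurable
      (h.abs_integral_pow_le hg hgc n)
  have hconst : ∫ z, g z ∂((Q ^ n) x) = ∫ y, (∫ z, g z ∂((Q ^ n) x)) ∂m := by simp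
  rw [hconst, ← integral_sub (integrable_const _) hi]
  refine abs_integral_le_integral_abs.trans <| (integral_mono ((integrable_const _).sub hi).abs
    (g := fun y => (1 - (1 - lam) * δ / 4) ^ n * K *
        ((1 + δ / (2 * b) * V x) + (1 + δ / (2 * b) * V y)))
    (((integrable_const _).add ((integrable_const _).add (hV.const_mul _))).const_mul _)
    fun y => h.osc_pow hg hgc hK hosc n x y).trans ?_
  rw [integral_const_mul]
  gcongr
  exact integral_weight_le hβ hV hv _

theorem osc_indicator {Q : Kernel X X} {V : X → ℝ} {lam b δ : ℝ} {ν : Measure X}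
    (h : HarrisCondition Q V lam b δ ν) (A : Set X) (x y : X) :
    |A.indicator (1 : X → ℝ) x - A.indicator (1 : X → ℝ) y|
      ≤ 1 * ((1 + δ / (2 * b) * V x) + (1 + δ / (2 * b) * V y)) := by
  have hβ : 0 ≤ δ / (2 * b) := by have := h.b_pos; have := h.delta_mem.1; positivity
  have h1 := mul_nonneg hβ (h.V_nonneg x)
  have h2 := mul_nonneg hβ (h.V_nonneg y)
  have : |A.indicator (1 : X → ℝ) x - A.indicator (1 : X → ℝ) y| ≤ 1 := by
    by_cases hx : x ∈ A <;> by_cases hy : y ∈ A <;> simp [hx, hy]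
  linarith

theorem abs_indicator_le {Q : Kernel X X} {V : X → ℝ} {lam b δ : ℝ} {ν : Measure X}
    (h : HarrisCondition Q V lam b δ ν) (A : Set X) (x : X) :
    |A.indicator (1 : X → ℝ) x| ≤ 1 * V x := by
  have := h.one_le x
  by_cases hx : x ∈ A <;> simp [hx] <;> linarith

/-- Comparing the start at `x₀` with a start from `Q x₀` shows that `Q^n(x₀, A)` is geometrically
Cauchy, uniformly in `A`. Its limit is therefore a probability measure, and no topology on `X` is
needed. -/
theorem exists_invariant [IsProbabilityMeasure ν] (h : HarrisCondition Q V lam b δ ν) [Nonempty X] :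
    ∃ η : Measure X, IsProbabilityMeasure η ∧ Kernel.Invariant Q η := by
  obtain ⟨hρ0, hρ1⟩ := rate_mem ⟨h.lam_pos, h.lam_lt⟩ h.delta_mem
  obtain ⟨x₀⟩ := ‹Nonempty X›
  set ρ := 1 - (1 - lam) * δ / 4 with hρ
  set D := (1 + δ / (2 * b) * V x₀) + (1 + δ / (2 * b) * (lam * V x₀ + b)) with hD
  have hreal : ∀ (m : Measure X) A, MeasurableSet A → m.real A = ∫ x, A.indicator 1 x ∂m :=
    fun m A hA => (integral_indicator_one hA).symm
  have hstep : ∀ A, MeasurableSet A → ∀ n,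
      dist (((Q ^ n) x₀).real A) (((Q ^ (n + 1)) x₀).real A) ≤ D * ρ ^ n := by
    intro A hA n
    have hm : Measurable (A.indicator (1 : X → ℝ)) := measurable_one.indicator hA
    rw [hreal _ A hA, hreal _ A hA, Real.dist_eq, integral_pow_succ
      (integrable_of_abs_le (h.integrable_V_pow _ _) hm (h.abs_indicator_le A))]
    have := h.osc_pow_measure hm (h.abs_indicator_le A) zero_le_one (h.osc_indicator A)
      (h.integrable_V x₀) (h.integral_V_le x₀) n x₀
    rwa [mul_one, mul_comm] at this
  choose! L hLlim using fun A hA => cauchySeq_tendsto_of_complete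
    (cauchySeq_of_le_geometric ρ D hρ1 (hstep A hA))
  have hbound : ∀ n A, MeasurableSet A → |((Q ^ n) x₀).real A - L A| ≤ D * ρ ^ n / (1 - ρ) :=
    fun n A hA => dist_le_of_le_geometric_of_tendsto ρ D hρ1 (hstep A hA) (hLlim A hA) n
  have hε : Tendsto (fun n => D * ρ ^ n / (1 - ρ)) atTop (𝓝 0) := by
    simpa using ((tendsto_pow_atTop_nhds_zero_of_lt_one hρ0.le hρ1).const_mul D).div_const (1 - ρ)
  obtain ⟨η, hη, hηL⟩ := exists_probabilityMeasure_of_uniform_limit hε hbound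
  refine ⟨η, hη, ?_⟩
  have hlim : ∀ A, MeasurableSet A →
      Tendsto (fun n => ((Q ^ n) x₀).real A) atTop (𝓝 (η.real A)) := fun A hA => by
    rw [hηL A hA]; exact hLlim A hA
  have : IsProbabilityMeasure (η.bind Q) := inferInstance
  refine Measure.ext fun A hA => ?_
  rw [← ENNReal.toReal_eq_toReal_iff' (measure_ne_top _ _) (measure_ne_top _ _)]
  change (η.bind Q).real A = η.real A
  have hm : Measurable (A.indicator (1 : X → ℝ)) := measurable_one.indicator hA
  have hind : ∀ (m : Measure X) [IsProbabilityMeasure m], Integrable (A.indicator (1 : X → ℝ)) m :=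
    fun m _ => (integrable_const (1 : ℝ)).indicator hA
  have hQA : ∀ m : Measure X, IsProbabilityMeasure m →
      (m.bind Q).real A = ∫ y, (Q y).real A ∂m := fun m _ => by
    rw [hreal _ A hA, integral_bind_kernel (hind _)]
    simp_rw [← hreal _ A hA]
  rw [hQA η hη]
  -- Invariance is the limit of `Q^{n+1}(x₀, A) = ∫ Q(y, A) Q^n(x₀, dy)`.
  have h1 : Tendsto (fun n => ∫ y, (Q y).real A ∂((Q ^ n) x₀)) atTop
      (𝓝 (∫ y, (Q y).real A ∂η)) :=
    tendsto_integral_of_setwise hlim (Q.measurable_coe hA).ennreal_toReal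
      (fun _ => measureReal_nonneg) fun _ => measureReal_le_one
  have h2 : (fun n => ∫ y, (Q y).real A ∂((Q ^ n) x₀)) = fun n => ((Q ^ (n + 1)) x₀).real A := by
    funext n
    rw [← hQA _ inferInstance, pow_succ']
    rfl
  rw [h2] at h1
  exact tendsto_nhds_unique h1 ((tendsto_add_atTop_iff_nat 1).2 (hlim A hA))

/-- Every invariant probability measure integrates the drift function. -/
theorem lintegral_V_le_of_invariant (h : HarrisCondition Q V lam b δ ν) {η : Measure X}
    [IsProbabilityMeasure η] (hη : Kernel.Invariant Q η) :
    ∫⁻ x, ENNReal.ofReal (V x) ∂η ≤ ENNReal.ofReal (b / (1 - lam)) := by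
  have hl := h.lam_pos
  have hl1 : 0 < 1 - lam := sub_pos.2 h.lam_lt
  have hb := h.b_pos
  have hVm := h.measurable.ennreal_ofReal
  have hkm : ∀ k : ℕ, Measurable fun x => min (ENNReal.ofReal (V x)) (k : ℝ≥0∞) := fun k =>
    hVm.min measurable_const
  -- Since `η(V)` might be infinite a priori, `η(V) ≤ lam η(V) + b` cannot be solved directly. For
  -- the truncation at `k`, invariance under `Q ^ n` and dominated convergence remove the term `lam
  -- ^ n * V x`.
  have htrunc : ∀ k : ℕ, ∫⁻ x, min (ENNReal.ofReal (V x)) (k : ℝ≥0∞) ∂η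
      ≤ ENNReal.ofReal (b / (1 - lam)) := by
    intro k
    have hn : ∀ n : ℕ, ∫⁻ x, min (ENNReal.ofReal (V x)) (k : ℝ≥0∞) ∂η
        ≤ ∫⁻ x, min (ENNReal.ofReal (lam ^ n * V x + b / (1 - lam))) (k : ℝ≥0∞) ∂η := by
      intro n
      conv_lhs => rw [← (invariant_pow hη n).def]
      rw [Measure.lintegral_bind (Kernel.aemeasurable _) (hkm k).aemeasurable]
      refine lintegral_mono fun x => le_min ?_ ?_
      · exact (lintegral_mono fun y => min_le_left _ _).trans (h.lintegral_pow_le n x)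
      · exact (lintegral_mono fun y => min_le_right _ _).trans (by simp)
    have hlim : Tendsto
        (fun n : ℕ => ∫⁻ x, min (ENNReal.ofReal (lam ^ n * V x + b / (1 - lam))) (k : ℝ≥0∞) ∂η)
        atTop (𝓝 (∫⁻ _, min (ENNReal.ofReal (b / (1 - lam))) (k : ℝ≥0∞) ∂η)) := by
      refine tendsto_lintegral_of_dominated_convergence (fun _ => (k : ℝ≥0∞)) (fun n => ?_)
        (fun n => ae_of_all _ fun x => min_le_right _ _) (by simp) (ae_of_all _ fun x => ?_)
      · exact ((h.measurable.const_mul _).add_const _).ennreal_ofReal.min measurable_const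
      · have h1 : Tendsto (fun n : ℕ => lam ^ n * V x + b / (1 - lam)) atTop
            (𝓝 (b / (1 - lam))) := by
          simpa using ((tendsto_pow_atTop_nhds_zero_of_lt_one hl.le h.lam_lt).mul_const
            (V x)).add_const (b / (1 - lam))
        exact (ENNReal.tendsto_ofReal h1).min tendsto_const_nhds
    refine (ge_of_tendsto' hlim hn).trans ?_
    rw [lintegral_const, measure_univ, mul_one]
    exact min_le_left _ _
  have hsup : ∀ x, ENNReal.ofReal (V x) = ⨆ k : ℕ, min (ENNReal.ofReal (V x)) (k : ℝ≥0∞) := by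
    intro x
    refine le_antisymm ?_ (iSup_le fun k => min_le_left _ _)
    obtain ⟨k, hk⟩ := ENNReal.exists_nat_gt (ENNReal.ofReal_ne_top (r := V x))
    exact le_iSup_of_le k (le_min le_rfl hk.le)
  rw [lintegral_congr hsup, lintegral_iSup hkm fun i j hij x => min_le_min_left _ (by exact_mod_cast hij)]
  exact iSup_le htrunc

theorem integrable_V_of_invariant (h : HarrisCondition Q V lam b δ ν) {η : Measure X}
    [IsProbabilityMeasure η] (hη : Kernel.Invariant Q η) : Integrable V η := by
  refine ⟨h.measurable.aestronglyMeasurable, ?_⟩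
  rw [hasFiniteIntegral_iff_ofReal (ae_of_all _ h.V_nonneg)]
  exact (h.lintegral_V_le_of_invariant hη).trans_lt ENNReal.ofReal_lt_top

theorem integral_V_le_of_invariant (h : HarrisCondition Q V lam b δ ν) {η : Measure X}
    [IsProbabilityMeasure η] (hη : Kernel.Invariant Q η) : ∫ x, V x ∂η ≤ b / (1 - lam) := by
  rw [integral_eq_lintegral_of_nonneg_ae (ae_of_all _ h.V_nonneg)
    h.measurable.aestronglyMeasurable]
  refine ENNReal.toReal_le_of_le_ofReal ?_ (h.lintegral_V_le_of_invariant hη)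
  have := h.b_pos; have := sub_pos.2 h.lam_lt; positivity

theorem osc_pow_invariant [IsProbabilityMeasure ν] (h : HarrisCondition Q V lam b δ ν) {g : X → ℝ} (hg : Measurable g)
    {c : ℝ} (hgc : ∀ x, |g x| ≤ c * V x) {K : ℝ} (hK : 0 ≤ K)
    (hosc : ∀ x y, |g x - g y| ≤ K * ((1 + δ / (2 * b) * V x) + (1 + δ / (2 * b) * V y)))
    {η : Measure X} [IsProbabilityMeasure η] (hη : Kernel.Invariant Q η) (n : ℕ) (x : X) :
    |∫ z, g z ∂((Q ^ n) x) - ∫ z, g z ∂η| ≤ (1 - (1 - lam) * δ / 4) ^ n * K *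
        ((1 + δ / (2 * b) * V x) + (1 + δ / (2 * b) * (b / (1 - lam)))) := by
  have hV := h.integrable_V_of_invariant hη
  have hint : ∫ z, g z ∂η = ∫ y, ∫ z, g z ∂((Q ^ n) y) ∂η := by
    conv_lhs => rw [← (invariant_pow hη n).def]
    refine integral_bind_kernel ?_
    rw [(invariant_pow hη n).def]
    exact integrable_of_abs_le hV hg hgc
  rw [hint]
  exact h.osc_pow_measure hg hgc hK hosc hV (h.integral_V_le_of_invariant hη) n x

theorem invariant_unique [IsProbabilityMeasure ν] (h : HarrisCondition Q V lam b δ ν) {η η' : Measure X}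
    [IsProbabilityMeasure η] [IsProbabilityMeasure η'] (hη : Kernel.Invariant Q η)
    (hη' : Kernel.Invariant Q η') : η = η' := by
  obtain ⟨hρ0, hρ1⟩ := rate_mem ⟨h.lam_pos, h.lam_lt⟩ h.delta_mem
  obtain ⟨x₀⟩ : Nonempty X := nonempty_of_isProbabilityMeasure η
  refine Measure.ext fun A hA => ?_
  rw [← ENNReal.toReal_eq_toReal_iff' (measure_ne_top _ _) (measure_ne_top _ _)]
  change η.real A = η'.real A
  have hm : Measurable (A.indicator (1 : X → ℝ)) := measurable_one.indicator hA
  have key : ∀ η : Measure X, IsProbabilityMeasure η → Kernel.Invariant Q η →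
      Tendsto (fun n => ∫ z, A.indicator 1 z ∂((Q ^ n) x₀)) atTop (𝓝 (η.real A)) := by
    intro η _ hη
    rw [← integral_indicator_one hA]
    refine tendsto_iff_dist_tendsto_zero.2 <| squeeze_zero (fun _ => dist_nonneg)
      (fun n => h.osc_pow_invariant hm (h.abs_indicator_le A) zero_le_one (h.osc_indicator A)
        hη n x₀) ?_
    simpa using (tendsto_pow_atTop_nhds_zero_of_lt_one hρ0.le hρ1).mul_const
      ((1 + δ / (2 * b) * V x₀) + (1 + δ / (2 * b) * (b / (1 - lam))))
  exact tendsto_nhds_unique (key η ‹_› hη) (key η' ‹_› hη')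

/-- `V`-geometric ergodicity with explicit constants. -/
theorem abs_integral_pow_sub_le [IsProbabilityMeasure ν] (h : HarrisCondition Q V lam b δ ν) {η : Measure X}
    [IsProbabilityMeasure η] (hη : Kernel.Invariant Q η) {f : X → ℝ} (hf : Measurable f)
    (hfV : ∀ x, |f x| ≤ V x) (n : ℕ) (x : X) :
    |∫ z, f z ∂((Q ^ n) x) - ∫ z, f z ∂η| ≤
      (4 * b / δ + 1 + b / (1 - lam)) * (1 - (1 - lam) * δ / 4) ^ n * V x := by
  have hb := h.b_pos
  have hδ := h.delta_mem.1
  have hl1 : 0 < 1 - lam := sub_pos.2 h.lam_lt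
  have hρ := (rate_mem ⟨h.lam_pos, h.lam_lt⟩ h.delta_mem).1.le
  have hK : 0 ≤ 2 * b / δ := by positivity
  -- The factor `2b/δ` is the inverse of the coefficient of `V` in the weight, so `|f| ≤ V` gives a
  -- weighted oscillation of at most `2b/δ`.
  have hone : 2 * b / δ * (δ / (2 * b)) = 1 := by field_simp
  have := h.osc_pow_invariant hf (c := 1) (by simpa using hfV) hK (fun x y => by
    calc |f x - f y| ≤ V x + V y := (abs_sub _ _).trans (add_le_add (hfV x) (hfV y))
      _ ≤ 2 * (2 * b / δ) + 2 * b / δ * (δ / (2 * b)) * (V x + V y) := by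
        rw [hone]; linarith
      _ = _ := by ring) hη n x
  refine this.trans ?_
  have hVx := h.one_le x
  have hq : 0 ≤ b / (1 - lam) := by positivity
  calc _ = (1 - (1 - lam) * δ / 4) ^ n * (2 * (2 * b / δ) + 2 * b / δ * (δ / (2 * b)) *
          (V x + b / (1 - lam))) := by ring
    _ = (1 - (1 - lam) * δ / 4) ^ n * (4 * b / δ + 1 * V x + b / (1 - lam)) := by
        rw [hone]; ring
    _ ≤ (1 - (1 - lam) * δ / 4) ^ n * ((4 * b / δ + 1 + b / (1 - lam)) * V x) := by
        have h4 : 0 ≤ 4 * b / δ := by positivity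
        gcongr
        nlinarith
    _ = _ := by ring

theorem vDist_pow_le [IsProbabilityMeasure ν] (h : HarrisCondition Q V lam b δ ν) {η : Measure X}
    [IsProbabilityMeasure η] (hη : Kernel.Invariant Q η) (n : ℕ) (x : X) :
    vDist V ((Q ^ n) x) η ≤ ENNReal.ofReal
      ((4 * b / δ + 1 + b / (1 - lam)) * (1 - (1 - lam) * δ / 4) ^ n * V x) :=
  iSup_le fun _ => iSup_le fun hf => iSup_le fun hfV =>
    ENNReal.ofReal_le_ofReal (h.abs_integral_pow_sub_le hη hf hfV n x)

end HarrisCondition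
end Harris
-- Acceptance probability
section Acceptance

variable {X : Type*} {p : X → ℝ} {β : ℝ}

theorem accept_le_one (x y : X) : accept p β x y ≤ 1 := min_le_left _ _

theorem accept_nonneg (hp : ∀ x, 0 < p x) (x y : X) : 0 ≤ accept p β x y := by
  have := hp x; have := hp y
  exact le_min zero_le_one (by positivity)

theorem accept_eq_one (hp : ∀ x, 0 < p x) (hβ : 0 ≤ β) {x y : X} (h : p x ≤ p y) :
    accept p β x y = 1 :=
  min_eq_left <| (one_le_div (Real.rpow_pos_of_pos (hp x) β)).2 <|
    Real.rpow_le_rpow (hp x).le h hβ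

/-- The right-hand side is symmetric in `x` and `y`; this gives detailed balance, and also the
regularity of the acceptance probability in `x`. -/
theorem accept_mul_rpow (hp : ∀ x, 0 < p x) (x y : X) :
    accept p β x y * p x ^ β = min (p x ^ β) (p y ^ β) := by
  have := Real.rpow_pos_of_pos (hp x) β
  rw [accept, min_mul_of_nonneg _ _ this.le, one_mul, div_mul_cancel₀ _ this.ne']

/-- Truncation at a level `p y ^ β` is 1-Lipschitz. The bound does not involve `y`, which makes the
later continuity estimates uniform over all proposal laws `θ`. -/
theorem abs_accept_sub_le (hp : ∀ x, 0 < p x) (x x' y : X) :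
    |accept p β x y - accept p β x' y| ≤ |p x ^ β - p x' ^ β| / p x ^ β := by
  have ha := Real.rpow_pos_of_pos (hp x) β
  have ha' := Real.rpow_pos_of_pos (hp x') β
  have ht := Real.rpow_pos_of_pos (hp y) β
  have e1 := accept_mul_rpow (β := β) hp x y
  have e2 := accept_mul_rpow (β := β) hp x' y
  have h1 := accept_le_one (p := p) (β := β) x' y
  have h0 := accept_nonneg (β := β) hp x' y
  set a := p x ^ β
  set a' := p x' ^ β
  set t := p y ^ β
  rw [le_div_iff₀ ha, ← abs_of_pos ha, ← abs_mul, abs_of_pos ha, sub_mul, e1]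
  have e3 : accept p β x' y * a = min a' t - accept p β x' y * (a' - a) := by rw [← e2]; ring
  rw [e3]
  rcases le_total a a' with h | h
  · rw [abs_of_nonpos (sub_nonpos.2 h)]
    have m1 : min a t ≤ min a' t := min_le_min_right _ h
    have m2 : min a' t ≤ min a t + (a' - a) := by
      rcases le_total a t with h' | h'
      · rw [min_eq_left h']; linarith [min_le_left a' t]
      · rw [min_eq_right h']; linarith [min_le_right a' t]
    have := mul_le_mul_of_nonneg_right h1 (sub_nonneg.2 h)
    have := mul_nonneg h0 (sub_nonneg.2 h)
    rw [abs_le]; constructor <;> linarith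
  · rw [abs_of_nonneg (sub_nonneg.2 h)]
    have m1 : min a' t ≤ min a t := min_le_min_right _ h
    have m2 : min a t ≤ min a' t + (a - a') := by
      rcases le_total a' t with h' | h'
      · rw [min_eq_left h']; linarith [min_le_left a t]
      · rw [min_eq_right h']; linarith [min_le_right a t]
    have := mul_le_mul_of_nonneg_right h1 (sub_nonneg.2 h)
    have := mul_nonneg h0 (sub_nonneg.2 h)
    rw [abs_le]; constructor <;> linarith

end Acceptance

/-! ### Powers of the target density as drift functions -/

section Lyapunov

variable {X : Type*} {p : X → ℝ} {σ β : ℝ}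

theorem le_supNorm (hp : ∀ x, 0 < p x) (hb : BddAbove (Set.range p)) (x : X) :
    p x ≤ supNorm p := by
  have h : (fun x => |p x|) = p := funext fun x => abs_of_pos (hp x)
  rw [supNorm, h]
  exact le_ciSup hb x

theorem supNorm_pos [Nonempty X] (hp : ∀ x, 0 < p x) (hb : BddAbove (Set.range p)) :
    0 < supNorm p :=
  (hp (Classical.arbitrary X)).trans_le (le_supNorm hp hb _)

theorem one_le_lyapunov (hp : ∀ x, 0 < p x) (hb : BddAbove (Set.range p)) (hσ : 0 ≤ σ) (x : X) :
    1 ≤ lyapunov p σ x := by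
  have : Nonempty X := ⟨x⟩
  have hN := supNorm_pos hp hb
  exact Real.one_le_rpow_of_pos_of_le_one_of_nonpos (div_pos (hp x) hN)
    ((div_le_one hN).2 (le_supNorm hp hb x)) (neg_nonpos.2 hσ)

theorem lyapunov_antitone (hp : ∀ x, 0 < p x) (hb : BddAbove (Set.range p)) (hσ : 0 ≤ σ) {x y : X}
    (h : p x ≤ p y) : lyapunov p σ y ≤ lyapunov p σ x := by
  have : Nonempty X := ⟨x⟩
  have hN := supNorm_pos hp hb
  exact Real.rpow_le_rpow_of_nonpos (div_pos (hp x) hN) (by gcongr) (neg_nonpos.2 hσ)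

theorem lyapunov_rpow (hp : ∀ x, 0 < p x) (hb : BddAbove (Set.range p)) {τ : ℝ} (hτ : τ ≠ 0)
    (x : X) : lyapunov p τ x ^ (σ / τ) = lyapunov p σ x := by
  have : Nonempty X := ⟨x⟩
  have hN := supNorm_pos hp hb
  rw [lyapunov, lyapunov, ← Real.rpow_mul (div_pos (hp x) hN).le]
  congr 1
  field_simp

theorem lyapunov_mono (hp : ∀ x, 0 < p x) (hb : BddAbove (Set.range p)) {τ : ℝ} (h : σ ≤ τ)
    (x : X) : lyapunov p σ x ≤ lyapunov p τ x := by
  have : Nonempty X := ⟨x⟩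
  have hN := supNorm_pos hp hb
  exact Real.rpow_le_rpow_of_exponent_ge (div_pos (hp x) hN)
    ((div_le_one hN).2 (le_supNorm hp hb x)) (neg_le_neg h)

/-- The acceptance probability compensates the growth of the Lyapunov function. -/
theorem accept_mul_lyapunov_le (hp : ∀ x, 0 < p x) (hb : BddAbove (Set.range p)) (hσ : 0 ≤ σ)
    (hσβ : σ ≤ β) (x y : X) : accept p β x y * lyapunov p σ y ≤ lyapunov p σ x := by
  have : Nonempty X := ⟨x⟩
  have hN := supNorm_pos hp hb
  have hy0 : 0 ≤ lyapunov p σ y := zero_le_one.trans (one_le_lyapunov hp hb hσ y)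
  rcases le_total (p x) (p y) with h | h
  · exact (mul_le_of_le_one_left hy0 (accept_le_one x y)).trans (lyapunov_antitone hp hb hσ h)
  · have hx := hp x
    have hy := hp y
    -- The ratio is at most one, so lowering the exponent from `β` to `σ` increases the power; the
    -- result cancels `V y / V x` exactly.
    have h1 : accept p β x y ≤ (p y / p x) ^ σ := by
      refine (min_le_right _ _).trans ?_
      rw [← Real.div_rpow hy.le hx.le]
      exact Real.rpow_le_rpow_of_exponent_ge (div_pos hy hx) ((div_le_one hx).2 h) hσβ
    refine (mul_le_mul_of_nonneg_right h1 hy0).trans_eq ?_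
    have h2 : p y / supNorm p = p y / p x * (p x / supNorm p) := by field_simp
    rw [lyapunov, lyapunov, h2, Real.mul_rpow (by positivity) (by positivity), ← mul_assoc,
      ← Real.rpow_add (by positivity), add_neg_cancel, Real.rpow_zero, one_mul]

theorem continuous_lyapunov [TopologicalSpace X] (hc : Continuous p) (hp : ∀ x, 0 < p x)
    (hb : BddAbove (Set.range p)) : Continuous (lyapunov p σ) := by
  refine continuous_iff_continuousAt.2 fun x => ?_
  have : Nonempty X := ⟨x⟩
  exact (hc.div_const _).continuousAt.rpow_const
    (Or.inl (div_pos (hp x) (supNorm_pos hp hb)).ne')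

theorem exists_le_of_lyapunov_le [Nonempty X] (hp : ∀ x, 0 < p x) (hb : BddAbove (Set.range p))
    (hσ : 0 < σ) (r : ℝ) :
    ∃ c ∈ Set.Ioo 0 (supNorm p), ∀ x, lyapunov p σ x ≤ r → c ≤ p x := by
  have hN := supNorm_pos hp hb
  -- Raising the level above 1 keeps the threshold for `p` strictly below `supNorm p`, where
  -- smallness is assumed.
  set R := max r 2 with hR
  have hR1 : 1 < R := lt_of_lt_of_le one_lt_two (le_max_right _ _)
  have hR0 : 0 < R := zero_lt_one.trans hR1
  have hq : 0 < R ^ (-σ⁻¹) := Real.rpow_pos_of_pos hR0 _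
  have hq1 : R ^ (-σ⁻¹) < 1 :=
    Real.rpow_lt_one_of_one_lt_of_neg hR1 (neg_lt_zero.2 (inv_pos.2 hσ))
  refine ⟨R ^ (-σ⁻¹) * supNorm p, ⟨by positivity, by nlinarith⟩, fun x hx => ?_⟩
  by_contra! hlt
  rw [← div_lt_iff₀ hN] at hlt
  have h1 := Real.rpow_lt_rpow_of_neg (div_pos (hp x) hN) hlt (neg_lt_zero.2 hσ)
  rw [← Real.rpow_mul hR0.le, neg_mul_neg, inv_mul_cancel₀ hσ.ne', Real.rpow_one] at h1
  exact absurd (hx.trans (le_max_left r 2)) (not_le.2 h1)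

end Lyapunov

/-! ### Integrals against the interaction and mixture kernels -/

section Kernels

variable {X : Type*} [MeasurableSpace X] {p : X → ℝ} {hp : Measurable p} {β υ : ℝ}
  {θ : ProbabilityMeasure X} {P : Kernel X X}

theorem measurable_accept_right (hp : Measurable p) (x : X) :
    Measurable fun y => accept p β x y :=
  (measurable_accept hp β).comp measurable_prodMk_left

theorem lintegral_interactionKernel (x : X) {f : X → ℝ≥0∞} (hf : Measurable f) :
    ∫⁻ y, f y ∂(interactionKernel p hp β θ x) =
      ∫⁻ y, (ENNReal.ofReal (accept p β x y) * f y + ENNReal.ofReal (1 - accept p β x y) * f x)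
        ∂(θ : Measure X) := by
  have hm := measurable_accept_right (β := β) hp x
  change ∫⁻ y, f y ∂(_ + _) = _
  rw [lintegral_add_measure, lintegral_withDensity_eq_lintegral_mul _ hm.ennreal_ofReal hf,
    lintegral_smul_measure, lintegral_dirac' _ hf]
  symm
  rw [lintegral_add_left (f := fun y => ENNReal.ofReal (accept p β x y) * f y)
    (hm.ennreal_ofReal.mul hf),
    lintegral_mul_const (f := fun y => ENNReal.ofReal (1 - accept p β x y)) _
      (measurable_const.sub hm).ennreal_ofReal]
  rfl

theorem isMarkovKernel_interactionKernel (hpos : ∀ x, 0 < p x) :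
    IsMarkovKernel (interactionKernel p hp β θ) := by
  refine ⟨fun x => ⟨?_⟩⟩
  rw [← lintegral_one, lintegral_interactionKernel x measurable_const]
  have : ∀ y, ENNReal.ofReal (accept p β x y) * 1 + ENNReal.ofReal (1 - accept p β x y) * 1 = 1 := by
    intro y
    rw [mul_one, mul_one, ← ENNReal.ofReal_add (accept_nonneg hpos x y)
      (sub_nonneg.2 (accept_le_one x y)), add_sub_cancel, ENNReal.ofReal_one]
  rw [lintegral_congr this, lintegral_one, measure_univ]

theorem integral_interactionKernel (hpos : ∀ x, 0 < p x) (x : X) {f : X → ℝ} (hf : Measurable f)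
    {c : ℝ} (hc : ∀ x, |f x| ≤ c) :
    ∫ y, f y ∂(interactionKernel p hp β θ x) =
      ∫ y, (accept p β x y * f y + (1 - accept p β x y) * f x) ∂(θ : Measure X) := by
  have hm := measurable_accept_right (β := β) hp x
  have := isMarkovKernel_interactionKernel (hp := hp) (β := β) (θ := θ) hpos
  have hint : ∀ (m : Measure X) [IsFiniteMeasure m], Integrable f m := fun m _ =>
    (integrable_const c).mono' hf.aestronglyMeasurable (ae_of_all _ hc)
  have hi : Integrable f (interactionKernel p hp β θ x) := hint _
  have ha : Integrable (fun y => accept p β x y) (θ : Measure X) :=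
    (integrable_const (1 : ℝ)).mono' hm.aestronglyMeasurable (ae_of_all _ fun y => by
      rw [Real.norm_eq_abs, abs_of_nonneg (accept_nonneg hpos x y)]; exact accept_le_one x y)
  have hadd : interactionKernel p hp β θ x =
      (θ : Measure X).withDensity (fun y => ENNReal.ofReal (accept p β x y)) +
      (∫⁻ y, ENNReal.ofReal (1 - accept p β x y) ∂(θ : Measure X)) • Measure.dirac x := rfl
  rw [hadd] at hi ⊢
  have hi' := integrable_add_measure.1 hi
  have hrej : (∫⁻ y, ENNReal.ofReal (1 - accept p β x y) ∂(θ : Measure X)).toReal =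
      ∫ y, (1 - accept p β x y) ∂(θ : Measure X) :=
    (integral_eq_lintegral_of_nonneg_ae (ae_of_all _ fun y => sub_nonneg.2 (accept_le_one x y))
      (measurable_const.sub hm).aestronglyMeasurable).symm
  rw [integral_add_measure hi'.1 hi'.2, integral_withDensity_eq_integral_toReal_smul
    hm.ennreal_ofReal (ae_of_all _ fun _ => ENNReal.ofReal_lt_top), integral_smul_measure,
    integral_dirac' _ _ hf.stronglyMeasurable, hrej,
    integral_add, integral_mul_const]
  · simp [ENNReal.toReal_ofReal (accept_nonneg hpos x _)]
  · exact (hint (θ : Measure X)).bdd_mul hm.aestronglyMeasurable (c := 1) (ae_of_all _ fun y => by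
      rw [Real.norm_eq_abs, abs_of_nonneg (accept_nonneg hpos x y)]; exact accept_le_one x y)
  · exact ((integrable_const 1).sub ha).mul_const _

theorem itKernel_apply (x : X) : itKernel υ P p hp β θ x =
    ENNReal.ofReal (1 - υ) • P x + ENNReal.ofReal υ • interactionKernel p hp β θ x := rfl

theorem lintegral_itKernel (x : X) (f : X → ℝ≥0∞) :
    ∫⁻ y, f y ∂(itKernel υ P p hp β θ x) = ENNReal.ofReal (1 - υ) * ∫⁻ y, f y ∂(P x) +
      ENNReal.ofReal υ * ∫⁻ y, f y ∂(interactionKernel p hp β θ x) := by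
  rw [itKernel_apply, lintegral_add_measure, lintegral_smul_measure, lintegral_smul_measure]
  rfl

theorem isMarkovKernel_itKernel [IsMarkovKernel P] (hpos : ∀ x, 0 < p x)
    (hυ : υ ∈ Set.Ioo (0 : ℝ) 1) : IsMarkovKernel (itKernel υ P p hp β θ) := by
  have := isMarkovKernel_interactionKernel (hp := hp) (β := β) (θ := θ) hpos
  refine ⟨fun x => ⟨?_⟩⟩
  rw [← lintegral_one, lintegral_itKernel]
  simp only [lintegral_one, measure_univ, mul_one]
  rw [← ENNReal.ofReal_add (sub_nonneg.2 hυ.2.le) hυ.1.le, sub_add_cancel, ENNReal.ofReal_one]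

theorem integral_itKernel [IsMarkovKernel P] (hpos : ∀ x, 0 < p x) (hυ : υ ∈ Set.Ioo (0 : ℝ) 1)
    (x : X) {f : X → ℝ} (hf : Measurable f) {c : ℝ} (hc : ∀ x, |f x| ≤ c) :
    ∫ y, f y ∂(itKernel υ P p hp β θ x) = (1 - υ) * ∫ y, f y ∂(P x) +
      υ * ∫ y, (accept p β x y * f y + (1 - accept p β x y) * f x) ∂(θ : Measure X) := by
  have := isMarkovKernel_interactionKernel (hp := hp) (β := β) (θ := θ) hpos
  have hint : ∀ (m : Measure X) [IsFiniteMeasure m], Integrable f m := fun m _ =>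
    (integrable_const c).mono' hf.aestronglyMeasurable (ae_of_all _ hc)
  rw [itKernel_apply, integral_add_measure ((hint _).smul_measure ENNReal.ofReal_ne_top)
    ((hint _).smul_measure ENNReal.ofReal_ne_top), integral_smul_measure, integral_smul_measure,
    ENNReal.toReal_ofReal (sub_nonneg.2 hυ.2.le), ENNReal.toReal_ofReal hυ.1.le,
    integral_interactionKernel hpos x hf hc]
  rfl

theorem ofReal_mul_le_itKernel (x : X) (A : Set X) :
    ENNReal.ofReal (1 - υ) * P x A ≤ itKernel υ P p hp β θ x A := by
  rw [itKernel_apply]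
  simp

end Kernels

/-! ### Drift of the interaction kernel and of `P` -/

section Drift

variable {X : Type*} [MeasurableSpace X] {p : X → ℝ} {hp : Measurable p} {σ β υ : ℝ}

theorem measurable_lyapunov (hp : Measurable p) : Measurable (lyapunov p σ) :=
  (hp.div_const _).pow_const _

/-- `K_θ V ≤ V + c` for every probability measure `θ`, with `c = θ(V)` when this is finite. -/
theorem exists_interactionKernel_drift (hpos : ∀ x, 0 < p x) (hb : BddAbove (Set.range p))
    (hσ : 0 ≤ σ) (hσβ : σ ≤ β) (θ : ProbabilityMeasure X) :
    ∃ c : ℝ, 0 ≤ c ∧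
      (∫⁻ x, ENNReal.ofReal (lyapunov p σ x) ∂(θ : Measure X) < ⊤ →
        c = (∫⁻ x, ENNReal.ofReal (lyapunov p σ x) ∂(θ : Measure X)).toReal) ∧
      ∀ x, ∫⁻ y, ENNReal.ofReal (lyapunov p σ y) ∂(interactionKernel p hp β θ x)
        ≤ ENNReal.ofReal (lyapunov p σ x + c) := by
  have : Nonempty X := nonempty_of_isProbabilityMeasure (θ : Measure X)
  have hN := supNorm_pos hpos hb
  have hV1 := one_le_lyapunov (σ := σ) hpos hb hσ
  have hV0 : ∀ x, 0 ≤ lyapunov p σ x := fun x => zero_le_one.trans (hV1 x)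
  have hVm : Measurable fun x => ENNReal.ofReal (lyapunov p σ x) :=
    (measurable_lyapunov hp).ennreal_ofReal
  have hα0 := accept_nonneg (β := β) hpos
  have hα1 := accept_le_one (p := p) (β := β)
  have hK : ∀ x, ∫⁻ y, ENNReal.ofReal (lyapunov p σ y) ∂(interactionKernel p hp β θ x) =
      ∫⁻ y, ENNReal.ofReal (accept p β x y * lyapunov p σ y +
        (1 - accept p β x y) * lyapunov p σ x) ∂(θ : Measure X) := fun x => by
    rw [lintegral_interactionKernel x hVm]
    refine lintegral_congr fun y => ?_
    rw [← ENNReal.ofReal_mul (hα0 x y), ← ENNReal.ofReal_mul (sub_nonneg.2 (hα1 x y)),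
      ← ENNReal.ofReal_add (mul_nonneg (hα0 x y) (hV0 y))
        (mul_nonneg (sub_nonneg.2 (hα1 x y)) (hV0 x))]
  have hrej : ∀ x y, (1 - accept p β x y) * lyapunov p σ x ≤ lyapunov p σ x := fun x y =>
    mul_le_of_le_one_left (hV0 x) (by linarith [hα0 x y])
  -- With a finite moment, the crude bounds `accept ≤ 1` and rejection probability at most one
  -- suffice.
  by_cases hfin : ∫⁻ x, ENNReal.ofReal (lyapunov p σ x) ∂(θ : Measure X) < ⊤
  · refine ⟨_, ENNReal.toReal_nonneg, fun _ => rfl, fun x => ?_⟩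
    rw [hK x, ENNReal.ofReal_add (hV0 x) ENNReal.toReal_nonneg, ENNReal.ofReal_toReal hfin.ne]
    calc _ ≤ ∫⁻ y, (ENNReal.ofReal (lyapunov p σ x) + ENNReal.ofReal (lyapunov p σ y))
            ∂(θ : Measure X) := lintegral_mono fun y => by
          rw [← ENNReal.ofReal_add (hV0 x) (hV0 y)]
          refine ENNReal.ofReal_le_ofReal ?_
          rw [add_comm]
          exact add_le_add (hrej x y) (mul_le_of_le_one_left (hV0 y) (hα1 x y))
      _ = _ := by rw [lintegral_add_left measurable_const]; simp
  · have hAm : ∀ n : ℕ, MeasurableSet {y | p y < 1 / ((n : ℝ) + 1)} := fun n =>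
      measurableSet_lt hp measurable_const
    have hlim : Tendsto (fun n : ℕ => (θ : Measure X) {y | p y < 1 / ((n : ℝ) + 1)}) atTop
        (𝓝 0) := by
      have hempty : ⋂ n : ℕ, {y | p y < 1 / ((n : ℝ) + 1)} = ∅ := by
        ext y
        simp only [Set.mem_iInter, Set.mem_ofPred_eq, Set.mem_empty_iff_false, iff_false, not_forall,
          not_lt]
        obtain ⟨n, hn⟩ := exists_nat_one_div_lt (hpos y)
        exact ⟨n, hn.le⟩
      have := tendsto_measure_iInter_atTop (μ := (θ : Measure X))
        (fun n => (hAm n).nullMeasurableSet) (fun i j hij y hy =>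
          lt_of_lt_of_le (show p y < _ from hy) (Nat.one_div_le_one_div hij))
        ⟨0, measure_ne_top _ _⟩
      rwa [hempty, measure_empty] at this
    -- Without a finite moment, positivity of `p` gives a level `r` with `θ {p < r} < 1/2`. The
    -- factor 1/2 offsets the factor 2 in `htwo`.
    obtain ⟨n, hn⟩ := (hlim.eventually (gt_mem_nhds
      (show (0 : ℝ≥0∞) < 2⁻¹ by simp))).exists
    set r : ℝ := 1 / ((n : ℝ) + 1) with hr
    have hr0 : 0 < r := by positivity
    set v : ℝ := (r / supNorm p) ^ (-σ) with hv
    have hv0 : 0 ≤ v := by positivity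
    have hVv : ∀ y, r ≤ p y → lyapunov p σ y ≤ v := fun y hy =>
      Real.rpow_le_rpow_of_nonpos (by positivity) (by gcongr) (neg_nonpos.2 hσ)
    refine ⟨v, hv0, fun h => absurd h hfin, fun x => ?_⟩
    rw [hK x]
    have htwo : ∀ y, accept p β x y * lyapunov p σ y + (1 - accept p β x y) * lyapunov p σ x
        ≤ 2 * lyapunov p σ x := fun y => by
      rw [two_mul]
      exact add_le_add (accept_mul_lyapunov_le hpos hb hσ hσβ x y) (hrej x y)
    -- For `p x ≥ r`, `2 V x ≤ V x + v`. For `p x < r`, proposals in `{p ≥ r}` are always accepted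
    -- and land where `V ≤ v`, while the others have mass below 1/2 and cost at most `2 V x`.
    rcases le_or_gt r (p x) with hx | hx
    · calc _ ≤ ∫⁻ _, ENNReal.ofReal (lyapunov p σ x + v) ∂(θ : Measure X) :=
            lintegral_mono fun y => ENNReal.ofReal_le_ofReal <|
              (htwo y).trans (by linarith [hVv x hx])
        _ = _ := by simp
    · calc _ ≤ ∫⁻ y, ({y | p y < r}.indicator (fun _ => ENNReal.ofReal (2 * lyapunov p σ x)) y
              + ENNReal.ofReal v) ∂(θ : Measure X) := lintegral_mono fun y => by
            by_cases hy : p y < r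
            · rw [Set.indicator_of_mem (show y ∈ {y | p y < r} from hy)]
              exact (ENNReal.ofReal_le_ofReal (htwo y)).trans le_self_add
            · rw [Set.indicator_of_notMem (show y ∉ {y | p y < r} from hy), zero_add,
                accept_eq_one hpos (hσ.trans hσβ) (hx.le.trans (not_lt.1 hy)), one_mul, sub_self,
                zero_mul, add_zero]
              exact ENNReal.ofReal_le_ofReal (hVv y (not_lt.1 hy))
        _ = ENNReal.ofReal (2 * lyapunov p σ x) * (θ : Measure X) {y | p y < r}
              + ENNReal.ofReal v := by
            rw [lintegral_add_right _ measurable_const, lintegral_indicator_const (hAm n),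
              lintegral_const, measure_univ, mul_one]
        _ ≤ ENNReal.ofReal (2 * lyapunov p σ x) * 2⁻¹ + ENNReal.ofReal v := by gcongr
        _ = _ := by
            rw [mul_comm 2, ENNReal.ofReal_mul (hV0 x), ENNReal.ofReal_ofNat, mul_assoc,
              ENNReal.mul_inv_cancel two_ne_zero ENNReal.ofNat_ne_top, mul_one,
              ENNReal.ofReal_add (hV0 x) hv0]

/-- A geometric drift condition is inherited by powers `W ^ s`, `0 < s ≤ 1`. -/
theorem drift_rpow {κ : Measure X} {W : X → ℝ} (hWm : Measurable W) (hW : ∀ x, 0 ≤ W x)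
    [IsProbabilityMeasure κ] {a s : ℝ} (ha : 0 < a) (hs0 : 0 ≤ s) (hs1 : s ≤ 1)
    (h : ∫⁻ y, ENNReal.ofReal (W y) ∂κ ≤ ENNReal.ofReal a) :
    ∫⁻ y, ENNReal.ofReal (W y ^ s) ∂κ ≤ ENNReal.ofReal (a ^ s) := by
  have hq := Real.rpow_pos_of_pos ha (s - 1)
  -- This is the tangent line at `a` of the concave function `t ↦ t ^ s`; integrating it gives
  -- Jensen's inequality with the bound `a` in place of the mean.
  have hpt : ∀ y, W y ^ s ≤ a ^ (s - 1) * s * W y + a ^ (s - 1) * (1 - s) * a := fun y => by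
    have h1 := Real.geom_mean_le_arith_mean2_weighted hs0 (sub_nonneg.2 hs1) (hW y) ha.le
      (add_sub_cancel s 1)
    calc W y ^ s = a ^ (s - 1) * (W y ^ s * a ^ (1 - s)) := by
          rw [mul_left_comm, ← Real.rpow_add ha]; simp
      _ ≤ a ^ (s - 1) * (s * W y + (1 - s) * a) := by gcongr
      _ = _ := by ring
  have h1s : 0 ≤ 1 - s := sub_nonneg.2 hs1
  calc ∫⁻ y, ENNReal.ofReal (W y ^ s) ∂κ
      ≤ ∫⁻ y, (ENNReal.ofReal (a ^ (s - 1) * s) * ENNReal.ofReal (W y)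
          + ENNReal.ofReal (a ^ (s - 1) * (1 - s) * a)) ∂κ := lintegral_mono fun y => by
        have := hW y
        rw [← ENNReal.ofReal_mul (by positivity), ← ENNReal.ofReal_add (by positivity)
          (by positivity)]
        exact ENNReal.ofReal_le_ofReal (hpt y)
    _ = ENNReal.ofReal (a ^ (s - 1) * s) * ∫⁻ y, ENNReal.ofReal (W y) ∂κ
          + ENNReal.ofReal (a ^ (s - 1) * (1 - s) * a) := by
        rw [lintegral_add_right _ measurable_const, lintegral_const_mul _ hWm.ennreal_ofReal]
        simp
    _ ≤ ENNReal.ofReal (a ^ (s - 1) * s) * ENNReal.ofReal a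
          + ENNReal.ofReal (a ^ (s - 1) * (1 - s) * a) := by gcongr
    _ = _ := by
        rw [← ENNReal.ofReal_mul (by positivity), ← ENNReal.ofReal_add (by positivity)
          (by positivity)]
        congr 1
        calc _ = a ^ (s - 1) * a := by ring
          _ = a ^ s := by rw [← Real.rpow_add_one ha.ne', sub_add_cancel]

/-- Take the power `σ / τ ≤ 1` of the drift inequality and split the right-hand side by
subadditivity of that power. Replacing `b` by `max b 1` makes the base positive. -/
theorem exists_lyapunov_drift {P : Kernel X X} [IsMarkovKernel P] (hp : Measurable p)
    (hpos : ∀ x, 0 < p x) (hb : BddAbove (Set.range p)) {τ : ℝ} (hσ : 0 < σ) (hστ : σ ≤ τ)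
    (h : ∃ lam ∈ Set.Ioo (0 : ℝ) 1, ∃ b : ℝ, ∀ x,
      ∫⁻ y, ENNReal.ofReal (lyapunov p τ y) ∂(P x) ≤ ENNReal.ofReal (lam * lyapunov p τ x + b)) :
    ∃ lam ∈ Set.Ioo (0 : ℝ) 1, ∃ b : ℝ, 0 < b ∧ ∀ x,
      ∫⁻ y, ENNReal.ofReal (lyapunov p σ y) ∂(P x)
        ≤ ENNReal.ofReal (lam * lyapunov p σ x + b) := by
  obtain ⟨lam, ⟨hl0, hl1⟩, b, hd⟩ := h
  have hτ : 0 < τ := hσ.trans_le hστ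
  have hs0 : 0 < σ / τ := div_pos hσ hτ
  have hs1 : σ / τ ≤ 1 := (div_le_one hτ).2 hστ
  have hb0 : (0 : ℝ) < max b 1 := lt_of_lt_of_le one_pos (le_max_right _ _)
  refine ⟨lam ^ (σ / τ), ⟨Real.rpow_pos_of_pos hl0 _, Real.rpow_lt_one hl0.le hl1 hs0⟩,
    max b 1 ^ (σ / τ), Real.rpow_pos_of_pos hb0 _, fun x => ?_⟩
  have hW0 : ∀ x, 0 ≤ lyapunov p τ x := fun x =>
    zero_le_one.trans (one_le_lyapunov hpos hb hτ.le x)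
  have hlW : 0 ≤ lam * lyapunov p τ x := mul_nonneg hl0.le (hW0 x)
  have h1 := drift_rpow (κ := P x) (measurable_lyapunov hp) hW0
    (add_pos_of_nonneg_of_pos hlW hb0) hs0.le hs1
    ((hd x).trans (ENNReal.ofReal_le_ofReal (by gcongr; exact le_max_left _ _)))
  simp_rw [lyapunov_rpow hpos hb hτ.ne'] at h1
  refine h1.trans (ENNReal.ofReal_le_ofReal ?_)
  refine (Real.rpow_add_le_add_rpow hlW hb0.le hs0.le hs1).trans_eq ?_
  rw [Real.mul_rpow hl0.le (hW0 x), lyapunov_rpow hpos hb hτ.ne']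

end Drift

/-! ### Irreducibility, aperiodicity and equicontinuity -/

section Structure

variable {X : Type*} [MeasurableSpace X] {p : X → ℝ} {hp : Measurable p} {β υ : ℝ}
  {θ : ProbabilityMeasure X} {P : Kernel X X}

theorem ofReal_pow_mul_le_itKernel_pow (n : ℕ) (x : X) (f : X → ℝ≥0∞) (hf : Measurable f) :
    ENNReal.ofReal (1 - υ) ^ n * ∫⁻ y, f y ∂((P ^ n) x) ≤
      ∫⁻ y, f y ∂((itKernel υ P p hp β θ ^ n) x) := by
  induction n generalizing x with
  | zero => simp
  | succ n ih =>
    rw [lintegral_pow_succ hf, lintegral_pow_succ hf, lintegral_itKernel, pow_succ', mul_assoc,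
      ← lintegral_const_mul _ (Measurable.lintegral_kernel hf)]
    refine le_trans ?_ le_self_add
    gcongr with y
    exact ih y

theorem isIrreducible_itKernel {φ : Measure X} (h : Kernel.IsIrreducible φ P) (hυ : υ < 1) :
    Kernel.IsIrreducible φ (itKernel υ P p hp β θ) where
  irreducible A hA hφ x := by
    obtain ⟨n, hn⟩ := h.irreducible hA hφ x
    refine ⟨n, ?_⟩
    have := ofReal_pow_mul_le_itKernel_pow (p := p) (hp := hp) (β := β) (θ := θ) (υ := υ) (P := P)
      n x (A.indicator 1) (measurable_one.indicator hA)
    rw [lintegral_indicator_one hA, lintegral_indicator_one hA] at this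
    refine lt_of_lt_of_le ?_ this
    exact ENNReal.mul_pos (pow_ne_zero _ (ENNReal.ofReal_pos.2 (sub_pos.2 hυ)).ne') hn.ne'

/-- A set null for `P_θ x` is null for `P x` because `P_θ ≥ (1 - υ) P`, so a cycle of `P_θ` is
already a cycle of `P`. -/
theorem isAperiodic_itKernel [IsMarkovKernel P] (hpos : ∀ x, 0 < p x)
    (hυ : υ ∈ Set.Ioo (0 : ℝ) 1) (h : IsAperiodic P) : IsAperiodic (itKernel υ P p hp β θ) := by
  rintro d hd ⟨D, hDm, hDn, hDd, hD⟩
  refine h d hd ⟨D, hDm, hDn, hDd, fun i x hx => ?_⟩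
  have := isMarkovKernel_itKernel (hp := hp) (β := β) (θ := θ) (P := P) hpos hυ
  have h0 : itKernel υ P p hp β θ x (D (i + 1))ᶜ = 0 :=
    (prob_compl_eq_zero_iff (hDm _)).2 (hD i x hx)
  have h1 := ofReal_mul_le_itKernel (υ := υ) (P := P) (hp := hp) (β := β) (θ := θ) x (D (i + 1))ᶜ
  rw [h0, nonpos_iff_eq_zero, mul_eq_zero] at h1
  refine (prob_compl_eq_zero_iff (hDm _)).1 (h1.resolve_left ?_)
  exact (ENNReal.ofReal_pos.2 (sub_pos.2 hυ.2)).ne'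

/-- The Feller property handles the `P` part. For the interaction part, the variation of the
acceptance probability in `x` is bounded independently of `y`, so integrating against any `θ` leaves
the modulus unchanged. -/
theorem equicontinuous_itKernel [TopologicalSpace X] [BorelSpace X] [IsMarkovKernel P]
    (hc : Continuous p) (hpos : ∀ x, 0 < p x) (hυ : υ ∈ Set.Ioo (0 : ℝ) 1) (hP : IsFeller P)
    (f : X →ᵇ ℝ) :
    Equicontinuous fun (θ : ProbabilityMeasure X) (x : X) =>
      ∫ y, f y ∂(itKernel υ P p hp β θ x) := by
  intro x₀
  have hfm : Measurable f := f.continuous.measurable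
  have hfb : ∀ x, |f x| ≤ ‖f‖ := fun x => f.norm_coe_le_norm x
  have ha := Real.rpow_pos_of_pos (hpos x₀) β
  have hpc : ContinuousAt (fun x => p x ^ β) x₀ :=
    hc.continuousAt.rpow_const (Or.inl (hpos x₀).ne')
  refine Metric.equicontinuousAt_of_continuity_modulus
    (fun x => (1 - υ) * |∫ y, f y ∂(P x₀) - ∫ y, f y ∂(P x)| +
      υ * (2 * ‖f‖ * (|p x₀ ^ β - p x ^ β| / p x₀ ^ β) + |f x₀ - f x|)) ?_ _
    (Eventually.of_forall fun x θ => ?_)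
  · have : ContinuousAt (fun x => (1 - υ) * |∫ y, f y ∂(P x₀) - ∫ y, f y ∂(P x)| +
      υ * (2 * ‖f‖ * (|p x₀ ^ β - p x ^ β| / p x₀ ^ β) + |f x₀ - f x|)) x₀ := by
      have h1 : ContinuousAt (fun x => ∫ y, f y ∂(P x)) x₀ := (hP f).continuousAt
      have h2 : ContinuousAt f x₀ := f.continuous.continuousAt
      fun_prop
    simpa [ContinuousAt] using this
  · rw [integral_itKernel hpos hυ x₀ hfm hfb, integral_itKernel hpos hυ x hfm hfb, Real.dist_eq]
    have hi : ∀ x, Integrable (fun y => accept p β x y * f y + (1 - accept p β x y) * f x)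
        (θ : Measure X) := fun x => by
      have hm := measurable_accept_right (β := β) hp x
      refine (integrable_const (‖f‖ + ‖f‖)).mono'
        ((hm.mul hfm).add ((measurable_const.sub hm).mul_const _)).aestronglyMeasurable
        (ae_of_all _ fun y => ?_)
      have h0 := accept_nonneg (β := β) hpos x y
      have h1 := accept_le_one (p := p) (β := β) x y
      refine (norm_add_le _ _).trans (add_le_add ?_ ?_)
      · rw [norm_mul, Real.norm_eq_abs, abs_of_nonneg h0]
        exact (mul_le_of_le_one_left (norm_nonneg _) h1).trans (hfb y)
      · rw [norm_mul, Real.norm_eq_abs, abs_of_nonneg (sub_nonneg.2 h1)]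
        exact (mul_le_of_le_one_left (norm_nonneg _) (by linarith)).trans (hfb x)
    have hK : |∫ y, (accept p β x₀ y * f y + (1 - accept p β x₀ y) * f x₀) ∂(θ : Measure X) -
        ∫ y, (accept p β x y * f y + (1 - accept p β x y) * f x) ∂(θ : Measure X)| ≤
        2 * ‖f‖ * (|p x₀ ^ β - p x ^ β| / p x₀ ^ β) + |f x₀ - f x| := by
      rw [← integral_sub (hi x₀) (hi x)]
      refine (abs_integral_le_integral_abs.trans (integral_mono ((hi x₀).sub (hi x)).abs
        (integrable_const (2 * ‖f‖ * (|p x₀ ^ β - p x ^ β| / p x₀ ^ β) + |f x₀ - f x|))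
        fun y => ?_)).trans_eq (by simp)
      have h0 := accept_nonneg (β := β) hpos x y
      have h1 := accept_le_one (p := p) (β := β) x y
      have hd := abs_accept_sub_le (β := β) hpos x₀ x y
      simp only [Pi.sub_apply]
      calc _ = |(accept p β x₀ y - accept p β x y) * (f y - f x₀)
              + (1 - accept p β x y) * (f x₀ - f x)| := by congr 1; ring
        _ ≤ |accept p β x₀ y - accept p β x y| * |f y - f x₀|
              + (1 - accept p β x y) * |f x₀ - f x| := by
            refine (abs_add_le _ _).trans ?_
            rw [abs_mul, abs_mul, abs_of_nonneg (sub_nonneg.2 h1)]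
        _ ≤ (|p x₀ ^ β - p x ^ β| / p x₀ ^ β) * (‖f‖ + ‖f‖) + 1 * |f x₀ - f x| := by
            gcongr
            · exact (abs_sub _ _).trans (add_le_add (hfb _) (hfb _))
            · linarith
        _ = _ := by ring
    have h1υ : 0 ≤ 1 - υ := sub_nonneg.2 hυ.2.le
    calc _ = |(1 - υ) * (∫ y, f y ∂(P x₀) - ∫ y, f y ∂(P x)) +
          υ * (∫ y, (accept p β x₀ y * f y + (1 - accept p β x₀ y) * f x₀) ∂(θ : Measure X) -
          ∫ y, (accept p β x y * f y + (1 - accept p β x y) * f x) ∂(θ : Measure X))| := by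
            congr 1; ring
      _ ≤ _ := by
          refine (abs_add_le _ _).trans ?_
          rw [abs_mul, abs_mul, abs_of_nonneg h1υ, abs_of_pos hυ.1]
          have := hυ.1
          gcongr

end Structure

/-! ### Invariance of the target at the tempered law -/

section Invariance

variable {X : Type*} [MeasurableSpace X] {p : X → ℝ} {hp : Measurable p} {β υ : ℝ}
  {P : Kernel X X} {μ : Measure X}

/-- `μ` has the finite density `1 / p` with respect to the finite target measure. This licenses the
exchange of integrals in detailed balance. -/
theorem sigmaFinite_of_density (hp : Measurable p) (hpos : ∀ x, 0 < p x)
    (hprob : ∫⁻ x, ENNReal.ofReal (p x) ∂μ = 1) : SigmaFinite μ := by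
  have hfin : IsFiniteMeasure (targetMeasure μ p) := isFiniteMeasure_withDensity (by simp [hprob])
  have h1 := withDensity_inv_same (μ := μ) hp.ennreal_ofReal
    (ae_of_all _ fun x => (ENNReal.ofReal_pos.2 (hpos x)).ne')
    (ae_of_all _ fun x => ENNReal.ofReal_ne_top)
  rw [← h1]
  exact SigmaFinite.withDensity_of_ne_top (μ := targetMeasure μ p)
    (ae_of_all _ fun x => ENNReal.inv_ne_top.2 (ENNReal.ofReal_pos.2 (hpos x)).ne')

/-- With the tempered proposal `p ^ (1 - β)`, the Metropolis–Hastings kernel is reversible for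
the target. -/
theorem isReversible_interactionKernel (hpos : ∀ x, 0 < p x)
    (hprob : ∫⁻ x, ENNReal.ofReal (p x) ∂μ = 1) {θ : ProbabilityMeasure X}
    (hθ : (θ : Measure X) = temperedMeasure μ p (1 - β)) :
    Kernel.IsReversible (interactionKernel p hp β θ) (targetMeasure μ p) := by
  have := sigmaFinite_of_density hp hpos hprob
  intro A B hA hB
  set c := (∫⁻ x, ENNReal.ofReal (p x ^ (1 - β)) ∂μ)⁻¹ with hc
  have hpm := hp.ennreal_ofReal
  have hqm : Measurable fun x => ENNReal.ofReal (p x ^ (1 - β)) := (hp.pow_const _).ennreal_ofReal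
  have hrm : Measurable fun x => ∫⁻ y, ENNReal.ofReal (1 - accept p β x y) ∂(θ : Measure X) :=
    (measurable_const.sub (measurable_accept hp β)).ennreal_ofReal.lintegral_prod_right'
  have ham : Measurable fun z : X × X => ENNReal.ofReal (accept p β z.1 z.2) :=
    (measurable_accept hp β).ennreal_ofReal
  -- Up to the constant `c`, `s` is the density of accepted flow: writing `p x = p x ^ (1 - β) * p x
  -- ^ β` turns `p x * p y ^ (1 - β) * accept` into this symmetric expression. Rejections contribute
  -- only on `A ∩ B`, also symmetrically.
  let s : X → X → ℝ≥0∞ := fun x y =>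
    ENNReal.ofReal (p x ^ (1 - β) * p y ^ (1 - β) * min (p x ^ β) (p y ^ β))
  have hs : ∀ x y, s x y = s y x := fun x y => by
    simp only [s, min_comm (p x ^ β), mul_comm (p x ^ (1 - β))]
  have hsm : Measurable (Function.uncurry s) := by
    have h1 : Measurable fun z : X × X => p z.1 := hp.comp measurable_fst
    have h2 : Measurable fun z : X × X => p z.2 := hp.comp measurable_snd
    exact (((h1.pow_const _).mul (h2.pow_const _)).mul
      ((h1.pow_const _).min (h2.pow_const _))).ennreal_ofReal
  have key : ∀ B, MeasurableSet B → ∀ x, ENNReal.ofReal (p x) *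
      ∫⁻ y in B, ENNReal.ofReal (accept p β x y) ∂(θ : Measure X) = c * ∫⁻ y in B, s x y ∂μ := by
    intro B hB x
    have hax : Measurable fun y => ENNReal.ofReal (accept p β x y) :=
      ham.comp measurable_prodMk_left
    have hsx : Measurable fun y => s x y := hsm.comp measurable_prodMk_left
    rw [hθ, temperedMeasure, Measure.restrict_smul, lintegral_smul_measure,
      setLIntegral_withDensity_eq_setLIntegral_mul _ hqm hax hB, smul_eq_mul, mul_left_comm,
      ← lintegral_const_mul _ (hqm.mul hax)]
    congr 1
    refine lintegral_congr fun y => ?_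
    have hx := hpos x
    have hy := hpos y
    simp only [Pi.mul_apply, s]
    rw [← ENNReal.ofReal_mul (by positivity), ← ENNReal.ofReal_mul hx.le]
    congr 1
    rw [← accept_mul_rpow hpos x y]
    have h1 : p x = p x ^ (1 - β) * p x ^ β := by
      rw [← Real.rpow_add hx, sub_add_cancel, Real.rpow_one]
    nth_rewrite 1 [h1]
    ring
  have hflow : ∀ A B, MeasurableSet A → MeasurableSet B →
      ∫⁻ x in A, interactionKernel p hp β θ x B ∂(targetMeasure μ p) =
        c * (∫⁻ x in A, ∫⁻ y in B, s x y ∂μ ∂μ) + ∫⁻ x in A ∩ B,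
          ∫⁻ y, ENNReal.ofReal (1 - accept p β x y) ∂(θ : Measure X) ∂(targetMeasure μ p) := by
    intro A B hA hB
    have hBm : Measurable fun x => ∫⁻ y in B, ENNReal.ofReal (accept p β x y) ∂(θ : Measure X) :=
      ham.lintegral_prod_right'
    have hsB : Measurable fun x => ∫⁻ y in B, s x y ∂μ := hsm.lintegral_prod_right'
    have h1 : ∀ x, interactionKernel p hp β θ x B =
        ∫⁻ y in B, ENNReal.ofReal (accept p β x y) ∂(θ : Measure X) +
        B.indicator (fun x => ∫⁻ y, ENNReal.ofReal (1 - accept p β x y) ∂(θ : Measure X)) x := by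
      intro x
      change (_ + _ : Measure X) B = _
      rw [Measure.add_apply, withDensity_apply _ hB, Measure.smul_apply, Measure.dirac_apply' _ hB,
        smul_eq_mul]
      by_cases hx : x ∈ B <;> simp [hx]
    rw [lintegral_congr h1, lintegral_add_left hBm, lintegral_indicator hB,
      Measure.restrict_restrict hB, Set.inter_comm B A]
    congr 1
    rw [targetMeasure, setLIntegral_withDensity_eq_setLIntegral_mul _ hpm hBm hA,
      ← lintegral_const_mul _ hsB]
    exact lintegral_congr fun x => key B hB x
  rw [hflow A B hA hB, hflow B A hB hA, Set.inter_comm B A,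
    lintegral_lintegral_swap (μ := μ.restrict A) (ν := μ.restrict B) hsm.aemeasurable]
  simp_rw [hs]

theorem invariant_itKernel [IsMarkovKernel P] (hpos : ∀ x, 0 < p x) (hυ : υ ∈ Set.Ioo (0 : ℝ) 1)
    (hprob : ∫⁻ x, ENNReal.ofReal (p x) ∂μ = 1) {θ : ProbabilityMeasure X}
    (hθ : (θ : Measure X) = temperedMeasure μ p (1 - β))
    (hP : Kernel.Invariant P (targetMeasure μ p)) :
    Kernel.Invariant (itKernel υ P p hp β θ) (targetMeasure μ p) := by
  have := isMarkovKernel_interactionKernel (hp := hp) (β := β) (θ := θ) hpos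
  have hK := (isReversible_interactionKernel (hp := hp) hpos hprob hθ).invariant
  refine Measure.ext fun A hA => ?_
  rw [Measure.bind_apply hA (Kernel.aemeasurable _)]
  simp_rw [itKernel_apply, Measure.add_apply, Measure.smul_apply, smul_eq_mul]
  rw [lintegral_add_left ((Kernel.measurable_coe _ hA).const_mul _),
    lintegral_const_mul _ (Kernel.measurable_coe _ hA),
    lintegral_const_mul _ (Kernel.measurable_coe _ hA),
    ← Measure.bind_apply hA (Kernel.aemeasurable _),
    ← Measure.bind_apply hA (Kernel.aemeasurable _), hP.def, hK.def, ← add_mul,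
    ← ENNReal.ofReal_add (sub_nonneg.2 hυ.2.le) hυ.1.le, sub_add_cancel, ENNReal.ofReal_one,
    one_mul]

end Invariance

/-! ### Almost sure weak convergence and iterates -/

section WeakConvergence

variable {X : Type*} [TopologicalSpace X] [MeasurableSpace X]

/-- Finite unions of a countable basis form a countable directed family inside each open set, so
continuity from below applies. Countability is what allows one exceptional null set for all test
functions. -/
theorem exists_open_family_exhausting (X : Type*) [TopologicalSpace X] [MeasurableSpace X]
    [SecondCountableTopology X] :
    ∃ U : Finset ℕ → Set X, (∀ s, IsOpen (U s)) ∧ ∀ G, IsOpen G → ∀ m : Measure X,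
      m G = ⨆ s : {s : Finset ℕ // U s ⊆ G}, m (U s) := by
  obtain ⟨b, hb⟩ := ((TopologicalSpace.countable_countableBasis X).insert ∅).exists_eq_range
    (Set.insert_nonempty _ _)
  have hB := (TopologicalSpace.isBasis_countableBasis X).insert_empty
  rw [hb] at hB
  have hunion : ∀ s t : Finset ℕ, ⋃ n ∈ s ∪ t, b n = (⋃ n ∈ s, b n) ∪ ⋃ n ∈ t, b n := fun s t =>
    Finset.set_biUnion_union s t b
  refine ⟨fun s => ⋃ n ∈ s, b n, fun s => isOpen_biUnion fun n _ => hB.isOpen ⟨n, rfl⟩,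
    fun G hG m => ?_⟩
  have hGU : G = ⋃ s : {s : Finset ℕ // ⋃ n ∈ s, b n ⊆ G}, ⋃ n ∈ s.1, b n := by
    refine Set.Subset.antisymm (fun x hx => ?_) (Set.iUnion_subset fun s => s.2)
    obtain ⟨_, ⟨n, rfl⟩, hxb, hbG⟩ := hB.exists_subset_of_mem_open hx hG
    have hn : ⋃ i ∈ ({n} : Finset ℕ), b i = b n := Finset.set_biUnion_singleton n b
    exact Set.mem_iUnion.2 ⟨⟨{n}, hn.le.trans hbG⟩, hn.symm.le hxb⟩
  have hdir : Directed (· ⊆ ·)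
      fun s : {s : Finset ℕ // ⋃ n ∈ s, b n ⊆ G} => ⋃ n ∈ s.1, b n := fun s t =>
    ⟨⟨s.1 ∪ t.1, (hunion _ _).le.trans (Set.union_subset s.2 t.2)⟩,
      Set.subset_union_left.trans (hunion _ _).symm.le,
      Set.subset_union_right.trans (hunion _ _).symm.le⟩
  conv_lhs => rw [hGU]
  exact hdir.measure_iUnion

/-- Almost sure convergence of the integrals of each bounded continuous function implies almost
sure weak convergence. -/
theorem ae_tendsto_probabilityMeasure [SecondCountableTopology X] [OpensMeasurableSpace X]
    [HasOuterApproxClosed X]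
    {Ω : Type*} [MeasurableSpace Ω] {Pr : Measure Ω} {θ : ℕ → Ω → ProbabilityMeasure X}
    {θs : ProbabilityMeasure X}
    (h : ∀ f : X → ℝ, Continuous f → (∃ c, ∀ x, |f x| ≤ c) →
      ∀ᵐ ω ∂Pr, Tendsto (fun n => ∫ x, f x ∂(θ n ω : Measure X)) atTop
        (𝓝 (∫ x, f x ∂(θs : Measure X)))) :
    ∀ᵐ ω ∂Pr, Tendsto (fun n => θ n ω) atTop (𝓝 θs) := by
  have hclosed : ∀ F : Set X, IsClosed F → ∀ᵐ ω ∂Pr,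
      limsup (fun n => (θ n ω : Measure X) F) atTop ≤ (θs : Measure X) F := by
    intro F hF
    have hk : ∀ k : ℕ, ∀ᵐ ω ∂Pr, Tendsto
        (fun n => ∫ x, (hF.apprSeq k x : ℝ) ∂(θ n ω : Measure X)) atTop
        (𝓝 (∫ x, (hF.apprSeq k x : ℝ) ∂(θs : Measure X))) := fun k =>
      h _ (NNReal.continuous_coe.comp (hF.apprSeq k).continuous) ⟨1, fun x => by
        rw [abs_of_nonneg (NNReal.coe_nonneg _)]
        exact_mod_cast HasOuterApproxClosed.apprSeq_apply_le_one hF k x⟩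
    filter_upwards [ae_all_iff.2 hk] with ω hω
    refine ge_of_tendsto' (HasOuterApproxClosed.tendsto_lintegral_apprSeq hF (θs : Measure X))
      fun k => ?_
    have hcoe : ∀ m : ProbabilityMeasure X, ∫⁻ x, (hF.apprSeq k x : ℝ≥0∞) ∂(m : Measure X) =
        ENNReal.ofReal (∫ x, (hF.apprSeq k x : ℝ) ∂(m : Measure X)) := fun m =>
      lintegral_coe_eq_integral _ <| (integrable_const (1 : ℝ)).mono'
        (NNReal.continuous_coe.comp (hF.apprSeq k).continuous).measurable.aestronglyMeasurable
        (ae_of_all _ fun x => by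
          rw [Real.norm_eq_abs, abs_of_nonneg (NNReal.coe_nonneg _)]
          exact_mod_cast HasOuterApproxClosed.apprSeq_apply_le_one hF k x)
    have hlim := ENNReal.tendsto_ofReal (hω k)
    simp_rw [← hcoe] at hlim
    rw [← hlim.limsup_eq]
    exact limsup_le_limsup (Eventually.of_forall fun n =>
      HasOuterApproxClosed.measure_le_lintegral hF (θ n ω : Measure X) k)
  obtain ⟨U, hU, hUG⟩ := exists_open_family_exhausting X
  -- On this single event the portmanteau inequality holds for every `U s`, and exhaustion extends
  -- it to all open sets.
  filter_upwards [ae_all_iff.2 fun s => hclosed (U s)ᶜ (hU s).isClosed_compl] with ω hω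
  have hUs : ∀ s, (θs : Measure X) (U s) ≤ liminf (fun n => (θ n ω : Measure X) (U s)) atTop := by
    intro s
    have := le_measure_compl_liminf_of_limsup_measure_le (hU s).isClosed_compl.measurableSet (hω s)
    simpa only [compl_compl] using this
  refine tendsto_of_forall_isOpen_le_liminf' fun G hG => ?_
  rw [hUG G hG]
  exact iSup_le fun s => (hUs s).trans <|
    liminf_le_liminf (Eventually.of_forall fun n => measure_mono s.2)

/-- Integrals of an equicontinuous, uniformly bounded, pointwise vanishing sequence against a weakly
convergent sequence of measures vanish in the limit. -/
theorem tendsto_integral_equicontinuous [OpensMeasurableSpace X] {m : ℕ → Measure X} {m₀ : Measure X}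
    [∀ n, IsProbabilityMeasure (m n)] [IsProbabilityMeasure m₀]
    (hm : ∀ f : X →ᵇ ℝ, Tendsto (fun n => ∫ x, f x ∂(m n)) atTop (𝓝 (∫ x, f x ∂m₀)))
    {h : ℕ → X → ℝ} (heq : Equicontinuous h) {C : ℝ} (hC : ∀ n x, |h n x| ≤ C)
    (h0 : ∀ x, Tendsto (fun n => h n x) atTop (𝓝 0)) :
    Tendsto (fun n => ∫ x, h n x ∂(m n)) atTop (𝓝 0) := by
  -- The tail supremum is continuous by equicontinuity and bounded, hence a legitimate test
  -- function. It dominates `|h n|` for `n ≥ k` and decreases to zero pointwise.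
  let H : ℕ → X → ℝ := fun k x => ⨆ n, |h (k + n) x|
  have hbdd : ∀ k x, BddAbove (Set.range fun n => |h (k + n) x|) := fun k x =>
    ⟨C, Set.forall_mem_range.2 fun n => hC _ x⟩
  have hle : ∀ k n x, k ≤ n → |h n x| ≤ H k x := fun k n x hkn => by
    have := le_ciSup (hbdd k x) (n - k)
    rwa [Nat.add_sub_cancel' hkn] at this
  have hH0 : ∀ k x, 0 ≤ H k x := fun k x => (abs_nonneg _).trans (hle k k x le_rfl)
  have hHC : ∀ k x, H k x ≤ C := fun k x => ciSup_le fun n => hC _ x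
  have hHcont : ∀ k, Continuous (H k) := by
    intro k
    refine continuous_iff_continuousAt.2 fun x₀ => Metric.tendsto_nhds.2 fun ε hε => ?_
    filter_upwards [Metric.equicontinuousAt_iff_right.1 (heq x₀) (ε / 2) (by positivity)] with x hx
    have key : ∀ y z, (∀ n, dist (h n y) (h n z) < ε / 2) → H k y ≤ H k z + ε / 2 := fun y z hyz =>
      ciSup_le fun n => by
        have h1 := hyz (k + n)
        rw [Real.dist_eq] at h1
        have h2 := abs_sub_abs_le_abs_sub (h (k + n) y) (h (k + n) z)
        have h3 := hle k (k + n) z (Nat.le_add_right _ _)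
        linarith
    have h1 := key x x₀ fun n => by rw [dist_comm]; exact hx n
    have h2 := key x₀ x hx
    rw [Real.dist_eq, abs_lt]
    constructor <;> linarith
  have hHint : ∀ k (m : Measure X) [IsProbabilityMeasure m], Integrable (H k) m := fun k m _ =>
    (integrable_const C).mono' (hHcont k).measurable.aestronglyMeasurable
      (ae_of_all _ fun x => by rw [Real.norm_eq_abs, abs_of_nonneg (hH0 k x)]; exact hHC k x)
  have hHlim : Tendsto (fun k => ∫ x, H k x ∂m₀) atTop (𝓝 0) := by
    have : Tendsto (fun k => ∫ x, H k x ∂m₀) atTop (𝓝 (∫ _, (0 : ℝ) ∂m₀)) := by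
      refine tendsto_integral_of_dominated_convergence (fun _ => C)
        (fun k => (hHcont k).measurable.aestronglyMeasurable) (integrable_const C)
        (fun k => ae_of_all _ fun x => by
          rw [Real.norm_eq_abs, abs_of_nonneg (hH0 k x)]; exact hHC k x)
        (ae_of_all _ fun x => Metric.tendsto_atTop.2 fun ε hε => ?_)
      obtain ⟨N, hN⟩ := Metric.tendsto_atTop.1 (h0 x) (ε / 2) (by positivity)
      refine ⟨N, fun k hk => ?_⟩
      have : H k x ≤ ε / 2 := ciSup_le fun n => by
        have := hN (k + n) (hk.trans (Nat.le_add_right _ _))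
        rw [Real.dist_eq, sub_zero] at this
        exact this.le
      rw [Real.dist_eq, sub_zero, abs_of_nonneg (hH0 k x)]
      linarith
    simpa using this
  refine Metric.tendsto_atTop.2 fun ε hε => ?_
  obtain ⟨k, hk⟩ := (hHlim.eventually (gt_mem_nhds hε)).exists
  have h1 := hm (BoundedContinuousFunction.ofNormedAddCommGroup (H k) (hHcont k) C fun x => by
    rw [Real.norm_eq_abs, abs_of_nonneg (hH0 k x)]; exact hHC k x)
  obtain ⟨N, hN⟩ := eventually_atTop.1 (h1.eventually (gt_mem_nhds hk))
  refine ⟨max N k, fun n hn => ?_⟩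
  rw [Real.dist_eq, sub_zero]
  have hhm : Integrable (h n) (m n) := (integrable_const C).mono'
    (heq.continuous n).measurable.aestronglyMeasurable (ae_of_all _ (hC n))
  calc |∫ x, h n x ∂(m n)| ≤ ∫ x, H k x ∂(m n) :=
        abs_integral_le_integral_abs.trans <| integral_mono hhm.abs (hHint k _) fun x =>
          hle k n x ((le_max_right _ _).trans hn)
    _ < ε := hN n ((le_max_left _ _).trans hn)

theorem abs_integral_le_of_bound {X : Type*} [MeasurableSpace X] {m : Measure X} [IsProbabilityMeasure m] {f : X → ℝ} {c : ℝ}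
    (hc : ∀ x, |f x| ≤ c) : |∫ x, f x ∂m| ≤ c := by
  have := norm_integral_le_of_norm_le_const (μ := m) (f := f) (C := c) (ae_of_all _ hc)
  simpa using this

theorem integral_pow_succ_bounded [OpensMeasurableSpace X] {Q : Kernel X X} [IsMarkovKernel Q]
    (k : ℕ) (x : X) (f : X →ᵇ ℝ) :
    ∫ z, f z ∂((Q ^ (k + 1)) x) = ∫ y, ∫ z, f z ∂(Q y) ∂((Q ^ k) x) := by
  have h : (Q ^ (k + 1)) x = ((Q ^ k) x).bind Q := by rw [pow_succ']; rfl
  have hi : Integrable f ((Q ^ (k + 1)) x) := (integrable_const ‖f‖).mono'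
    f.continuous.measurable.aestronglyMeasurable (ae_of_all _ f.norm_coe_le_norm)
  rw [h] at hi ⊢
  exact integral_bind_kernel hi

/-- Weak convergence of one-step transitions passes to the iterates, under equicontinuity. -/
theorem tendsto_integral_pow [OpensMeasurableSpace X] {Q : ℕ → Kernel X X} {Q₀ : Kernel X X}
    [∀ n, IsMarkovKernel (Q n)] [IsMarkovKernel Q₀]
    (hw : ∀ x (f : X →ᵇ ℝ), Tendsto (fun n => ∫ y, f y ∂(Q n x)) atTop (𝓝 (∫ y, f y ∂(Q₀ x))))
    (heq : ∀ f : X →ᵇ ℝ, Equicontinuous fun n x => ∫ y, f y ∂(Q n x)) (hF : IsFeller Q₀) (k : ℕ)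
    (x : X) (f : X →ᵇ ℝ) :
    Tendsto (fun n => ∫ y, f y ∂((Q n ^ k) x)) atTop (𝓝 (∫ y, f y ∂((Q₀ ^ k) x))) := by
  induction k generalizing f with
  | zero => simp
  | succ k ih =>
    simp_rw [integral_pow_succ_bounded]
    have hb : ∀ (Q : Kernel X X) [IsMarkovKernel Q] x, |∫ y, f y ∂(Q x)| ≤ ‖f‖ := fun Q _ x =>
      abs_integral_le_of_bound f.norm_coe_le_norm
    have hint : ∀ (Q : Kernel X X) [IsMarkovKernel Q] (m : Measure X) [IsProbabilityMeasure m],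
        Integrable (fun x => ∫ y, f y ∂(Q x)) m := fun Q _ m _ =>
      (integrable_const ‖f‖).mono'
        f.continuous.measurable.stronglyMeasurable.integral_kernel.aestronglyMeasurable
        (ae_of_all _ (hb Q))
    have h1 := ih (BoundedContinuousFunction.ofNormedAddCommGroup (fun x => ∫ y, f y ∂(Q₀ x))
      (hF f) ‖f‖ (hb Q₀))
    -- Peeling off the last step splits the integral into `Q_n^k (Q₀ f)`, covered by the induction
    -- since `Q₀ f` is continuous, and `Q_n^k (Q_n f - Q₀ f)`, where kernel and integrand both vary
    -- with `n`.
    have h2 : Tendsto (fun n => ∫ x, (∫ y, f y ∂(Q n x) - ∫ y, f y ∂(Q₀ x)) ∂((Q n ^ k) x))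
        atTop (𝓝 0) := by
      refine tendsto_integral_equicontinuous ih (fun x₀ => ?_) (C := ‖f‖ + ‖f‖)
        (fun n x => (abs_sub _ _).trans (add_le_add (hb _ x) (hb _ x))) (fun x => ?_)
      · refine Metric.equicontinuousAt_iff_right.2 fun ε hε => ?_
        filter_upwards [Metric.equicontinuousAt_iff_right.1 (heq f x₀) (ε / 2) (by positivity),
          Metric.tendsto_nhds.1 ((hF f).tendsto x₀) (ε / 2) (by positivity)] with x hx hx' n
        have := dist_sub_sub_le (∫ y, f y ∂(Q n x₀)) (∫ y, f y ∂(Q₀ x₀)) (∫ y, f y ∂(Q n x))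
          (∫ y, f y ∂(Q₀ x))
        have := hx n
        rw [dist_comm] at hx'
        linarith
      · simpa using (hw x f).sub_const (∫ y, f y ∂(Q₀ x))
    have h3 := h2.add h1
    rw [zero_add] at h3
    refine h3.congr fun n => ?_
    rw [integral_sub (hint _ _) (hint _ _)]
    simp

/-- Interchange of limits under a uniform rate. -/
theorem tendsto_of_uniform_rate {a : ℕ → ℕ → ℝ} {a₀ : ℕ → ℝ} {l : ℕ → ℝ} {l₀ : ℝ} {e : ℕ → ℝ}
    (ha : ∀ k, Tendsto (fun n => a n k) atTop (𝓝 (a₀ k))) (he : Tendsto e atTop (𝓝 0))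
    (h : ∀ n k, |a n k - l n| ≤ e k) (h₀ : ∀ k, |a₀ k - l₀| ≤ e k) :
    Tendsto l atTop (𝓝 l₀) := by
  refine Metric.tendsto_atTop.2 fun ε hε => ?_
  obtain ⟨k, hk⟩ := (he.eventually (gt_mem_nhds (show (0 : ℝ) < ε / 3 by positivity))).exists
  obtain ⟨N, hN⟩ := Metric.tendsto_atTop.1 (ha k) (ε / 3) (by positivity)
  refine ⟨N, fun n hn => ?_⟩
  have h1 := abs_le.1 (h n k)
  have h2 := abs_le.1 (h₀ k)
  have h3 := hN n hn
  rw [Real.dist_eq, abs_lt] at h3 ⊢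
  constructor <;> linarith

variable {p : X → ℝ} {hp : Measurable p} {β υ : ℝ} {P : Kernel X X}

theorem tendsto_integral_itKernel [BorelSpace X] [IsMarkovKernel P] (hc : Continuous p)
    (hpos : ∀ x, 0 < p x) (hυ : υ ∈ Set.Ioo (0 : ℝ) 1) {θ : ℕ → ProbabilityMeasure X}
    {θs : ProbabilityMeasure X} (h : Tendsto θ atTop (𝓝 θs)) (x : X) (f : X →ᵇ ℝ) :
    Tendsto (fun n => ∫ y, f y ∂(itKernel υ P p hp β (θ n) x)) atTop
      (𝓝 (∫ y, f y ∂(itKernel υ P p hp β θs x))) := by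
  simp_rw [integral_itKernel hpos hυ x f.continuous.measurable f.norm_coe_le_norm]
  refine Tendsto.const_add _ (Tendsto.const_mul _ ?_)
  have hac : Continuous fun y => accept p β x y :=
    continuous_const.min ((hc.rpow_const fun y => Or.inl (hpos y).ne').div_const _)
  have hgc : Continuous fun y => accept p β x y * f y + (1 - accept p β x y) * f x :=
    (hac.mul f.continuous).add ((continuous_const.sub hac).mul continuous_const)
  have hb : ∀ y, ‖accept p β x y * f y + (1 - accept p β x y) * f x‖ ≤ ‖f‖ + ‖f‖ := fun y => by
    have h0 := accept_nonneg (β := β) hpos x y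
    have h1 := accept_le_one (p := p) (β := β) x y
    refine (norm_add_le _ _).trans (add_le_add ?_ ?_)
    · rw [norm_mul, Real.norm_eq_abs, abs_of_nonneg h0]
      exact (mul_le_of_le_one_left (norm_nonneg _) h1).trans (f.norm_coe_le_norm y)
    · rw [norm_mul, Real.norm_eq_abs, abs_of_nonneg (sub_nonneg.2 h1)]
      exact (mul_le_of_le_one_left (norm_nonneg _) (by linarith)).trans (f.norm_coe_le_norm x)
  exact ProbabilityMeasure.tendsto_iff_forall_integral_tendsto.1 h
    (BoundedContinuousFunction.ofNormedAddCommGroup _ hgc _ hb)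

end WeakConvergence

/-! ### From Harris' condition to admissible constants -/

section Rates

variable {X Θ : Type*} [MeasurableSpace X] {Q : Θ → Kernel X X} [∀ θ, IsMarkovKernel (Q θ)]
  {V : X → ℝ} {lam : ℝ} {b δ : Θ → ℝ} {ν : Θ → Measure X} [∀ θ, IsProbabilityMeasure (ν θ)]

/-- Declaring `2 * b θ` as drift constant makes the required small-set level `2 (2b) / (1 - lam) -
1` the one used in the contraction. Exponent 2 suffices in the bound because each term of the
constants is a product of at most two of `b`, `δ⁻¹`, `(1 - lam)⁻¹`, and `δ⁻¹ > 1`. -/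
theorem isErgodicRate_of_harris (h : ∀ θ, HarrisCondition (Q θ) V lam (b θ) (δ θ) (ν θ))
    (hl : lam < 1) {πinv : Θ → ProbabilityMeasure X}
    (hπ : ∀ θ, Kernel.Invariant (Q θ) (πinv θ : Measure X)) :
    IsErgodicRate Q πinv V (fun θ => 2 * b θ) δ (fun _ => lam)
      (fun θ => 4 * b θ / δ θ + 1 + b θ / (1 - lam)) (fun θ => 1 - (1 - lam) * δ θ / 4) where
  invariant := hπ
  moment θ := by
    have hb := (h θ).b_pos
    have hl1 : 0 < 1 - lam := sub_pos.2 hl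
    refine ((h θ).lintegral_V_le_of_invariant (hπ θ)).trans (ENNReal.ofReal_le_ofReal ?_)
    rw [div_eq_mul_inv]
    gcongr
    linarith
  rho_mem θ := HarrisCondition.rate_mem ⟨(h θ).lam_pos, hl⟩ (h θ).delta_mem
  ergodic θ n x := (h θ).vDist_pow_le (hπ θ) n x
  bound := by
    refine ⟨4, 2, by norm_num, by norm_num, fun θ => ?_⟩
    have hb := (h θ).b_pos
    have hl0 := (h θ).lam_pos
    have hl1 : 0 < 1 - lam := sub_pos.2 hl
    obtain ⟨hδ0, hδ1⟩ := (h θ).delta_mem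
    set M := max (2 * b θ) (max (δ θ)⁻¹ (1 - lam)⁻¹) with hM
    have h1 : 2 * b θ ≤ M := le_max_left _ _
    have h2 : (δ θ)⁻¹ ≤ M := (le_max_left _ _).trans (le_max_right _ _)
    have h3 : (1 - lam)⁻¹ ≤ M := (le_max_right _ _).trans (le_max_right _ _)
    have hM1 : 1 ≤ M := ((one_le_inv₀ hδ0).2 hδ1.le).trans h2
    have hM0 : 0 ≤ M := zero_le_one.trans hM1
    have hbδ : 2 * b θ * (δ θ)⁻¹ ≤ M * M := by gcongr
    have hbl : 2 * b θ * (1 - lam)⁻¹ ≤ M * M := by gcongr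
    have hδl : (1 - lam)⁻¹ * (δ θ)⁻¹ ≤ M * M := by gcongr
    have hMM : 1 ≤ M * M := by nlinarith
    rw [rateConst, Real.rpow_two, sq]
    refine max_le ?_ ?_
    · rw [div_eq_mul_inv, div_eq_mul_inv]
      have : 0 ≤ b θ * (1 - lam)⁻¹ := by positivity
      linarith
    · have : (1 - (1 - (1 - lam) * δ θ / 4))⁻¹ = 4 * ((1 - lam)⁻¹ * (δ θ)⁻¹) := by
        rw [sub_sub_cancel]; field_simp
      rw [this]
      linarith

theorem driftMinorization_of_harris {φ : Measure X}
    (h : ∀ θ, HarrisCondition (Q θ) V lam (b θ) (δ θ) (ν θ)) (hl : lam ∈ Set.Ioo (0 : ℝ) 1)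
    (hV : Measurable V) (hV1 : ∀ x, 1 ≤ V x)
    (hirr : ∀ θ, Kernel.IsIrreducible φ (Q θ)) (haper : ∀ θ, IsAperiodic (Q θ)) :
    DriftMinorization φ Q V (fun θ => 2 * b θ) δ (fun _ => lam) ν where
  markov := inferInstance
  irreducible := hirr
  aperiodic := haper
  measurable_V := hV
  one_le_V := hV1
  delta_mem θ := (h θ).delta_mem
  lam_mem _ := hl
  prob_nu := inferInstance
  drift θ x := ((h θ).drift x).trans
    (ENNReal.ofReal_le_ofReal (by linarith [(h θ).b_pos]))
  minorization θ x hx := (h θ).minor x (hx.trans_eq (by rw [div_eq_mul_inv]; ring))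

end Rates

/-! ### Harris' condition uniformly in `θ` -/

section UniformHarris

variable {X : Type*} [MeasurableSpace X] {p : X → ℝ} {hp : Measurable p} {β υ τ : ℝ}
  {P : Kernel X X}

theorem exists_minorization_lyapunov [Nonempty X] {σ : ℝ} (hpos : ∀ x, 0 < p x)
    (hb : BddAbove (Set.range p)) (hσ : 0 < σ)
    (hsmall : ∀ c ∈ Set.Ioo (0 : ℝ) (supNorm p), IsOneSmall P {x | c ≤ p x}) (r : ℝ) :
    ∃ ε ∈ Set.Ioo (0 : ℝ) 1, ∃ ν : Measure X, IsProbabilityMeasure ν ∧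
      ∀ x, lyapunov p σ x ≤ r → ∀ A, MeasurableSet A → ENNReal.ofReal ε * ν A ≤ P x A := by
  obtain ⟨c, hc, hcV⟩ := exists_le_of_lyapunov_le hpos hb hσ r
  obtain ⟨ε, hε, ν, hν, hle⟩ := hsmall c hc
  -- Capping `ε` at 1/2 makes it finite and strictly below 1.
  have hmin : min ε 2⁻¹ ≠ ⊤ := ((min_le_right _ _).trans_lt (by simp)).ne
  have hhalf : (min ε 2⁻¹).toReal ≤ (2⁻¹ : ℝ≥0∞).toReal :=
    ENNReal.toReal_mono (by simp) (min_le_right _ _)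
  refine ⟨(min ε 2⁻¹).toReal, ⟨ENNReal.toReal_pos (lt_min hε (by simp)).ne' hmin, ?_⟩, ν, hν,
    fun x hx A hA => ?_⟩
  · refine hhalf.trans_lt ?_
    rw [ENNReal.toReal_inv, ENNReal.toReal_ofNat]
    norm_num
  · rw [ENNReal.ofReal_toReal hmin]
    exact (mul_le_mul_left (min_le_left _ _) _).trans (hle x (hcV x hx) A hA)

/-- Harris' condition holds for all `P_θ`, with a common Lyapunov function and rate, and with
constants controlled by `θ(V)`. -/
theorem exists_harrisCondition [IsMarkovKernel P] [Nonempty X] (hpos : ∀ x, 0 < p x) (hb : BddAbove (Set.range p))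
    (hβ : 0 < β) (hυ : υ ∈ Set.Ioo (0 : ℝ) 1) (hτ : 0 < τ)
    (hdrift : ∃ lam ∈ Set.Ioo (0 : ℝ) 1, ∃ b : ℝ, ∀ x,
      ∫⁻ y, ENNReal.ofReal (lyapunov p τ y) ∂(P x) ≤ ENNReal.ofReal (lam * lyapunov p τ x + b))
    (hsmall : ∀ c ∈ Set.Ioo (0 : ℝ) (supNorm p), IsOneSmall P {x | c ≤ p x}) :
    ∃ σ ∈ Set.Ioc 0 τ, ∃ lam ∈ Set.Ioo (0 : ℝ) 1, ∃ (b δ : ProbabilityMeasure X → ℝ)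
      (ν : ProbabilityMeasure X → Measure X), (∀ θ, IsProbabilityMeasure (ν θ)) ∧
      (∀ θ, HarrisCondition (itKernel υ P p hp β θ) (lyapunov p σ) lam (b θ) (δ θ) (ν θ)) ∧
      ∀ R : ℝ, ∃ bmax δmin : ℝ, 0 < δmin ∧ ∀ θ : ProbabilityMeasure X,
        ∫⁻ x, ENNReal.ofReal (lyapunov p σ x) ∂(θ : Measure X) < ⊤ →
        (∫⁻ x, ENNReal.ofReal (lyapunov p σ x) ∂(θ : Measure X)).toReal ≤ R →
        b θ ≤ bmax ∧ δmin ≤ δ θ := by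
  obtain ⟨hυ0, hυ1⟩ := hυ
  have h1υ : 0 < 1 - υ := sub_pos.2 hυ1
  -- `σ ≤ τ` is needed for the drift of `P`, `σ ≤ β` for that of the interaction kernel.
  set σ := min τ β with hσdef
  have hσ : 0 < σ := lt_min hτ hβ
  obtain ⟨lamP, ⟨hlP0, hlP1⟩, bP, hbP, hPd⟩ :=
    exists_lyapunov_drift hp hpos hb hσ (min_le_left τ β) hdrift
  choose ε hε ν hν hmin using fun k : ℕ =>
    exists_minorization_lyapunov hpos hb hσ hsmall (k : ℝ)
  choose c hc0 hcfin hcd using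
    exists_interactionKernel_drift (hp := hp) hpos hb hσ.le (min_le_right τ β)
  have hV0 : ∀ x, 0 ≤ lyapunov p σ x := fun x =>
    zero_le_one.trans (one_le_lyapunov hpos hb hσ.le x)
  set lam := (1 - υ) * lamP + υ with hlam
  have hl0 : 0 < lam := by positivity
  have hl1 : lam < 1 := by nlinarith
  have hl1' : 0 < 1 - lam := sub_pos.2 hl1
  let b : ProbabilityMeasure X → ℝ := fun θ => (1 - υ) * bP + υ * c θ
  have hb0 : ∀ θ, 0 < b θ := fun θ => add_pos_of_pos_of_nonneg (mul_pos h1υ hbP)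
    (mul_nonneg hυ0.le (hc0 θ))
  -- Small sets are taken at integer levels, so that a bounded range of `b θ` involves only finitely
  -- many minorization constants.
  let k : ProbabilityMeasure X → ℕ := fun θ => ⌈4 * b θ / (1 - lam)⌉₊
  refine ⟨σ, ⟨hσ, min_le_left _ _⟩, lam, ⟨hl0, hl1⟩, b, fun θ => (1 - υ) * ε (k θ),
    fun θ => ν (k θ), fun θ => hν _, fun θ => ?_, fun R => ?_⟩
  · refine
      { measurable := measurable_lyapunov hp
        one_le := one_le_lyapunov hpos hb hσ.le
        lam_pos := hl0
        lam_lt := hl1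
        b_pos := hb0 θ
        drift := fun x => ?_
        delta_mem := ⟨mul_pos h1υ (hε _).1, by nlinarith [(hε (k θ)).1, (hε (k θ)).2]⟩
        minor := fun x hx A hA => ?_ }
    · have hVx := hV0 x
      have hcθ := hc0 θ
      rw [lintegral_itKernel]
      calc _ ≤ ENNReal.ofReal (1 - υ) * ENNReal.ofReal (lamP * lyapunov p σ x + bP) +
            ENNReal.ofReal υ * ENNReal.ofReal (lyapunov p σ x + c θ) := by
              gcongr
              · exact hPd x
              · exact hcd θ x
        _ = _ := by
            rw [← ENNReal.ofReal_mul h1υ.le, ← ENNReal.ofReal_mul hυ0.le,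
              ← ENNReal.ofReal_add (by positivity) (by positivity)]
            congr 1
            simp only [b, hlam]
            ring
    · refine le_trans ?_ (ofReal_mul_le_itKernel x A)
      rw [ENNReal.ofReal_mul h1υ.le, mul_assoc]
      gcongr
      refine hmin (k θ) x (hx.trans ?_) A hA
      linarith [Nat.le_ceil (4 * b θ / (1 - lam))]
  · let bmax := (1 - υ) * bP + υ * R
    let K := ⌈4 * bmax / (1 - lam)⌉₊
    -- The minimum of finitely many positive `ε` is positive; no monotonicity of `ε` in the level is
    -- required.
    obtain ⟨j, -, hj⟩ := (Finset.range (K + 1)).exists_min_image ε ⟨0, by simp⟩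
    refine ⟨bmax, (1 - υ) * ε j, mul_pos h1υ (hε j).1, fun θ hfin hR => ?_⟩
    have hbb : b θ ≤ bmax := by
      have := hcfin θ hfin
      simp only [b, bmax]
      gcongr
      exact this.le.trans hR
    refine ⟨hbb, ?_⟩
    change (1 - υ) * ε j ≤ (1 - υ) * ε (k θ)
    gcongr
    refine hj _ (Finset.mem_range.2 (Nat.lt_succ_of_le ?_))
    exact Nat.ceil_mono (by gcongr)

end UniformHarris

/-! ### Stability of the invariant law -/

/-- Continuity of the invariant distribution along a sequence of parameters for which the one-step
transitions converge weakly and Harris' condition holds with bounded constants. -/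
theorem tendsto_integral_invariant {X : Type*} [TopologicalSpace X] [MeasurableSpace X]
    [OpensMeasurableSpace X] {Q : ℕ → Kernel X X} {Q₀ : Kernel X X}
    [∀ n, IsMarkovKernel (Q n)] [IsMarkovKernel Q₀]
    (hw : ∀ x (f : X →ᵇ ℝ), Tendsto (fun n => ∫ y, f y ∂(Q n x)) atTop (𝓝 (∫ y, f y ∂(Q₀ x))))
    (heq : ∀ f : X →ᵇ ℝ, Equicontinuous fun n x => ∫ y, f y ∂(Q n x)) (hF : IsFeller Q₀)
    {V : X → ℝ} {lam : ℝ} {b δ : ℕ → ℝ} {b₀ δ₀ : ℝ} {ν : ℕ → Measure X} {ν₀ : Measure X}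
    [∀ n, IsProbabilityMeasure (ν n)] [IsProbabilityMeasure ν₀]
    (h : ∀ n, HarrisCondition (Q n) V lam (b n) (δ n) (ν n))
    (h₀ : HarrisCondition Q₀ V lam b₀ δ₀ ν₀) {bmax δmin : ℝ} (hδmin : 0 < δmin)
    (hb : ∀ n, b n ≤ bmax) (hδ : ∀ n, δmin ≤ δ n) (hb₀ : b₀ ≤ bmax) (hδ₀ : δmin ≤ δ₀)
    {η : ℕ → Measure X} {η₀ : Measure X} [∀ n, IsProbabilityMeasure (η n)]
    [IsProbabilityMeasure η₀] (hη : ∀ n, Kernel.Invariant (Q n) (η n))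
    (hη₀ : Kernel.Invariant Q₀ η₀) (f : X →ᵇ ℝ) :
    Tendsto (fun n => ∫ x, f x ∂(η n)) atTop (𝓝 (∫ x, f x ∂η₀)) := by
  obtain ⟨x₀⟩ : Nonempty X := nonempty_of_isProbabilityMeasure η₀
  have hl0 := h₀.lam_pos
  have hl1 : 0 < 1 - lam := sub_pos.2 h₀.lam_lt
  have hbmax : 0 < bmax := h₀.b_pos.trans_le hb₀
  have hδmin1 : δmin < 1 := hδ₀.trans_lt h₀.delta_mem.2
  obtain ⟨hρ0, hρ1⟩ := HarrisCondition.rate_mem ⟨hl0, h₀.lam_lt⟩ ⟨hδmin, hδmin1⟩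
  have hN : 0 < ‖f‖ + 1 := by positivity
  have hVx := h₀.V_nonneg x₀
  let e : ℕ → ℝ := fun k => (‖f‖ + 1) * ((4 * bmax / δmin + 1 + bmax / (1 - lam)) *
    (1 - (1 - lam) * δmin / 4) ^ k * V x₀)
  have he : Tendsto e atTop (𝓝 0) := by
    simpa using (((tendsto_pow_atTop_nhds_zero_of_lt_one hρ0.le hρ1).const_mul
      (4 * bmax / δmin + 1 + bmax / (1 - lam))).mul_const (V x₀)).const_mul (‖f‖ + 1)
  have key : ∀ (Q : Kernel X X) [IsMarkovKernel Q] (b δ : ℝ) (ν η : Measure X)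
      [IsProbabilityMeasure ν] [IsProbabilityMeasure η], HarrisCondition Q V lam b δ ν →
      b ≤ bmax → δmin ≤ δ → Kernel.Invariant Q η → ∀ k,
      |∫ y, f y ∂((Q ^ k) x₀) - ∫ y, f y ∂η| ≤ e k := by
    intro Q _ b δ ν η _ _ hH hb hδ hη k
    have hb0 := hH.b_pos
    have hδ0 := hH.delta_mem.1
    have hρ := (HarrisCondition.rate_mem ⟨hl0, h₀.lam_lt⟩ hH.delta_mem).1.le
    -- Rescaling brings `f` below `1 ≤ V`; the extra 1 avoids dividing by zero when `f = 0`.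
    have h1 := hH.abs_integral_pow_sub_le hη (f := fun x => (‖f‖ + 1)⁻¹ * f x)
      (f.continuous.measurable.const_mul _) (fun x => by
        refine le_trans ?_ (hH.one_le x)
        rw [abs_mul, abs_of_pos (inv_pos.2 hN), inv_mul_le_one₀ hN]
        exact (f.norm_coe_le_norm x).trans (by linarith)) k x₀
    rw [integral_const_mul, integral_const_mul, ← mul_sub, abs_mul, abs_of_pos (inv_pos.2 hN),
      inv_mul_le_iff₀ hN] at h1
    refine h1.trans ?_
    simp only [e]
    gcongr
  exact tendsto_of_uniform_rate (a := fun n k => ∫ y, f y ∂((Q n ^ k) x₀))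
    (a₀ := fun k => ∫ y, f y ∂((Q₀ ^ k) x₀))
    (fun k => tendsto_integral_pow hw heq hF k x₀ f) he
    (fun n k => key (Q n) (b n) (δ n) (ν n) (η n) (h n) (hb n) (hδ n) (hη n) k)
    fun k => key Q₀ b₀ δ₀ ν₀ η₀ h₀ hb₀ hδ₀ hη₀ k

theorem lintegral_empirical_lt_top {X Ω : Type*} [MeasurableSpace X] (Y : ℕ → Ω → X) (n : ℕ)
    (ω : Ω) {V : X → ℝ} (hV : Measurable V) :
    ∫⁻ x, ENNReal.ofReal (V x) ∂(empirical Y n ω : Measure X) < ⊤ := by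
  change ∫⁻ x, ENNReal.ofReal (V x)
    ∂(((n : ℝ≥0∞) + 1)⁻¹ • ∑ k ∈ Finset.range (n + 1), Measure.dirac (Y k ω)) < ⊤
  rw [lintegral_smul_measure, lintegral_finsetSum_measure]
  simp_rw [lintegral_dirac' _ hV.ennreal_ofReal]
  refine ENNReal.mul_lt_top (by simp) (ENNReal.sum_lt_top.2 fun _ _ => ENNReal.ofReal_lt_top)

end InteractingTempering

/-! ### Assembly -/

open InteractingTempering in
theorem proposition3p3
    {X : Type*} [TopologicalSpace X] [PolishSpace X] [MeasurableSpace X] [BorelSpace X]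
    {Ω : Type*} [mΩ : MeasurableSpace Ω] (Pr : Measure Ω) [IsProbabilityMeasure Pr]
    (ℱ : Filtration ℕ mΩ)
    (μ : Measure X) (p : X → ℝ) (P : Kernel X X) [IsMarkovKernel P]
    (T υ τ : ℝ) (hT : 1 < T) (hυ : υ ∈ Set.Ioo (0 : ℝ) 1)
    (θstar : ProbabilityMeasure X)
    (hθstar : (θstar : Measure X) = temperedMeasure μ p (1 / T))
    -- the target density
    (hp_cont : Continuous p) (hp_pos : ∀ x, 0 < p x) (hp_bdd : BddAbove (Set.range p))
    (hp_prob : ∫⁻ x, ENNReal.ofReal (p x) ∂μ = 1)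
    -- the kernel `P`
    (hP_irr : Kernel.IsIrreducible (targetMeasure μ p) P) (hP_aper : IsAperiodic P)
    (hP_feller : IsFeller P) (hP_inv : Kernel.Invariant P (targetMeasure μ p))
    (hτ : τ ∈ Set.Ioo (0 : ℝ) (1 / T))
    (hP_drift : ∃ lam ∈ Set.Ioo (0 : ℝ) 1, ∃ b : ℝ, ∀ x,
      ∫⁻ y, ENNReal.ofReal (lyapunov p τ y) ∂(P x) ≤ ENNReal.ofReal (lam * lyapunov p τ x + b))
    (hP_small : ∀ c ∈ Set.Ioo (0 : ℝ) (supNorm p), IsOneSmall P {x | c ≤ p x})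
    -- the auxiliary process
    (Y : ℕ → Ω → X) (hY_adapted : ∀ n, Measurable[ℱ n] (Y n))
    (hθstar_W : ∫⁻ x, ENNReal.ofReal (lyapunov p τ x) ∂(θstar : Measure X) < ⊤)
    (hY_lln : ∀ f : X → ℝ, Continuous f → (∃ c : ℝ, ∀ x, |f x| ≤ c * lyapunov p τ x) →
      ∀ᵐ ω ∂Pr, Tendsto (fun n => ∫ x, f x ∂(empirical Y n ω : Measure X)) atTop
        (𝓝 (∫ x, f x ∂(θstar : Measure X))))
    (hY_moment : (⨆ n, ∫⁻ ω, ENNReal.ofReal (lyapunov p τ (Y n ω)) ∂Pr) < ⊤)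
    -- the interacting process
    (ξ : ℕ → Ω → X) (hξ_adapted : ∀ n, Measurable[ℱ n] (ξ n))
    (hξ_transition : ∀ (n : ℕ) (f : X → ℝ), Measurable f → (∃ c : ℝ, ∀ x, |f x| ≤ c) →
      Pr[fun ω => f (ξ (n + 1) ω) | ℱ n] =ᵐ[Pr] fun ω =>
        ∫ y, f y ∂(itKernel υ P p hp_cont.measurable (1 - 1 / T) (empirical Y n ω) (ξ n ω)))
    (hξ_init : ∫⁻ ω, ENNReal.ofReal (lyapunov p τ (ξ 0 ω)) ∂Pr < ⊤) :
    ∃ πinv : ProbabilityMeasure X → ProbabilityMeasure X,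
      -- `πinv θ` is the unique invariant distribution of `P_θ`
      (∀ θ η : ProbabilityMeasure X,
        Kernel.Invariant (itKernel υ P p hp_cont.measurable (1 - 1 / T) θ) (η : Measure X) ↔
          η = πinv θ) ∧
      InvariantConvergenceConditions Pr (targetMeasure μ p)
        (itKernel υ P p hp_cont.measurable (1 - 1 / T)) πinv (empirical Y) θstar ∧
      ∀ f : X →ᵇ ℝ, ∀ᵐ ω ∂Pr,
        Tendsto (fun n => ∫ x, f x ∂(πinv (empirical Y n ω) : Measure X)) atTop
          (𝓝 (∫ x, f x ∂(targetMeasure μ p))) := by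
  obtain ⟨hυ0, hυ1⟩ := id hυ
  obtain ⟨hτ0, hτ1⟩ := hτ
  have hX : Nonempty X := nonempty_of_isProbabilityMeasure (θstar : Measure X)
  have hβ : 0 < 1 - 1 / T := sub_pos.2 ((div_lt_one (by linarith)).2 hT)
  have htarget : IsProbabilityMeasure (targetMeasure μ p) := ⟨by simp [targetMeasure, hp_prob]⟩
  have hpm := hp_cont.measurable
  have hM : ∀ θ, IsMarkovKernel (itKernel υ P p hpm (1 - 1 / T) θ) := fun θ =>
    isMarkovKernel_itKernel hp_pos hυ
  have heq : ∀ f : X →ᵇ ℝ, Equicontinuous fun (θ : ProbabilityMeasure X) (x : X) =>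
      ∫ y, f y ∂(itKernel υ P p hpm (1 - 1 / T) θ x) :=
    equicontinuous_itKernel hp_cont hp_pos hυ hP_feller
  obtain ⟨σ, ⟨hσ0, hστ⟩, lam, hlam, b, δ, ν, hν, hH, hbound⟩ := exists_harrisCondition
    (hp := hpm) (β := 1 - 1 / T) hp_pos hp_bdd hβ hυ hτ0 hP_drift hP_small
  have hV1 := one_le_lyapunov hp_pos hp_bdd hσ0.le
  have hV0 : ∀ x, 0 ≤ lyapunov p σ x := fun x => zero_le_one.trans (hV1 x)
  have hVm : Measurable (lyapunov p σ) := measurable_lyapunov hpm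
  have hVW : ∀ x, lyapunov p σ x ≤ lyapunov p τ x := lyapunov_mono hp_pos hp_bdd hστ
  have hW1 := one_le_lyapunov hp_pos hp_bdd hτ0.le
  choose η hη hηinv using fun θ => (hH θ).exists_invariant
  let πinv : ProbabilityMeasure X → ProbabilityMeasure X := fun θ => ⟨η θ, hη θ⟩
  have hinv : ∀ θ, Kernel.Invariant (itKernel υ P p hpm (1 - 1 / T) θ) (πinv θ : Measure X) :=
    hηinv
  have hrate := isErgodicRate_of_harris hH hlam.2 hinv
  -- almost surely, `θ_n` converges weakly to `θ⋆` and the constants are bounded along `θ_n`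
  have hweak : ∀ᵐ ω ∂Pr, Tendsto (fun n => empirical Y n ω) atTop (𝓝 θstar) := by
    refine ae_tendsto_probabilityMeasure fun f hf ⟨c, hc⟩ => hY_lln f hf ⟨|c|, fun x => ?_⟩
    calc |f x| ≤ |c| * 1 := by rw [mul_one]; exact (hc x).trans (le_abs_self c)
      _ ≤ |c| * lyapunov p τ x := by gcongr; exact hW1 x
  have hconst : ∀ᵐ ω ∂Pr, ∃ bmax δmin : ℝ, 0 < δmin ∧
      (∀ n, b (empirical Y n ω) ≤ bmax ∧ δmin ≤ δ (empirical Y n ω)) ∧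
      b θstar ≤ bmax ∧ δmin ≤ δ θstar := by
    -- `V` is continuous and `V ≤ W`, so the law of large numbers applies to `V` itself. A
    -- convergent sequence is bounded, and any upper bound of it also bounds the limit `θ⋆(V)`.
    have hV := hY_lln (lyapunov p σ) (continuous_lyapunov hp_cont hp_pos hp_bdd) ⟨1, fun x => by
      rw [abs_of_nonneg (hV0 x), one_mul]; exact hVW x⟩
    filter_upwards [hV] with ω hω
    obtain ⟨R, hR⟩ := hω.bddAbove_range
    have htoReal : ∀ θ : ProbabilityMeasure X,
        (∫⁻ x, ENNReal.ofReal (lyapunov p σ x) ∂(θ : Measure X)).toReal =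
          ∫ x, lyapunov p σ x ∂(θ : Measure X) := fun θ =>
      (integral_eq_lintegral_of_nonneg_ae (ae_of_all _ hV0) hVm.aestronglyMeasurable).symm
    have hstar : ∫⁻ x, ENNReal.ofReal (lyapunov p σ x) ∂(θstar : Measure X) < ⊤ :=
      (lintegral_mono fun x => ENNReal.ofReal_le_ofReal (hVW x)).trans_lt hθstar_W
    have hRn : ∀ n, ∫ x, lyapunov p σ x ∂(empirical Y n ω : Measure X) ≤ R := fun n => hR ⟨n, rfl⟩
    obtain ⟨bmax, δmin, hδmin, h⟩ := hbound R
    exact ⟨bmax, δmin, hδmin,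
      fun n => h _ (lintegral_empirical_lt_top Y n ω hVm) ((htoReal _).trans_le (hRn n)),
      h _ hstar ((htoReal _).trans_le (le_of_tendsto' hω hRn))⟩
  have hstar_inv : Kernel.Invariant (itKernel υ P p hpm (1 - 1 / T) θstar)
      (targetMeasure μ p) :=
    invariant_itKernel hp_pos hυ hp_prob (by rw [hθstar, sub_sub_cancel]) hP_inv
  refine ⟨πinv, fun θ η' => ⟨fun h => Subtype.ext ?_, fun h => h ▸ hinv θ⟩, ⟨?_, heq, fun x => ?_⟩,
    fun f => ?_⟩
  · exact (hH θ).invariant_unique (η := (η' : Measure X)) (η' := (πinv θ : Measure X)) h (hinv θ)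
  · refine ⟨lyapunov p σ, fun θ => 2 * b θ, δ, fun _ => lam, ν,
      driftMinorization_of_harris hH hlam hVm hV1 (fun θ => isIrreducible_itKernel hP_irr hυ1)
        (fun θ => isAperiodic_itKernel hp_pos hυ hP_aper), ⟨_, _, hrate⟩, fun C ρ hCρ => ?_⟩
    -- For arbitrary admissible `C`, `ρ`, only their own polynomial bound is used; it is evaluated
    -- at drift and minorization constants that are bounded along `θ_n`.
    obtain ⟨C₀, γ, hC₀, hγ, hle⟩ := hCρ.bound
    filter_upwards [hconst] with ω ⟨bmax, δmin, hδmin, hn, _⟩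
    have hδpos : ∀ θ, 0 < δ θ := fun θ => (hH θ).delta_mem.1
    refine lt_of_le_of_lt (limsup_le_of_le (h := Eventually.of_forall fun n =>
      ENNReal.ofReal_le_ofReal ((hle (empirical Y n ω)).trans ?_))) (ENNReal.ofReal_lt_top
      (r := C₀ * (max (2 * bmax) (max δmin⁻¹ (1 - lam)⁻¹)) ^ γ))
    obtain ⟨h1, h2⟩ := hn n
    have h3 : 0 ≤ max (2 * b (empirical Y n ω)) (max (δ (empirical Y n ω))⁻¹ (1 - lam)⁻¹) :=
      (inv_nonneg.2 (hδpos _).le).trans ((le_max_left _ _).trans (le_max_right _ _))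
    gcongr
  · filter_upwards [hweak] with ω hω f
    exact tendsto_integral_itKernel hp_cont hp_pos hυ hω x f
  · filter_upwards [hweak, hconst] with ω hω ⟨bmax, δmin, hδmin, hn, hb0, hδ0⟩
    -- The limit law is taken to be the target itself, invariant for `P_{θ⋆}`. The Feller property
    -- of `P_{θ⋆}` is read off from the equicontinuity.
    exact tendsto_integral_invariant
      (fun x f => tendsto_integral_itKernel hp_cont hp_pos hυ hω x f)
      (fun f x₀ => (heq f x₀).comp fun n => empirical Y n ω)
      (fun f => (heq f).continuous θstar)
      (fun n => hH (empirical Y n ω)) (hH θstar) hδmin (fun n => (hn n).1) (fun n => (hn n).2)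
      hb0 hδ0 (fun n => hinv _) hstar_inv f
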